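/- Let $K$ be an arbitrary field and let $n$ be a positive integer. Let $K\langle x_1,\dots,x_n\rangle$ be the free associative unital algebra, graded by giving each $x_i$ degree $1$. Then, with $d=\lceil n^2/3\rceil$, there exist $d$ linearly independent elements $r_1,\dots,r_d\in K\langle x_1,\dots,x_n\rangle$, each homogeneous of degree $2$, such that the quadratic algebra $R=K\langle x_1,\dots,x_n\rangle/(r_1,\dots,r_d)$ is $5$-step nilpotent: $R_5=0$, where $R_k$ denotes the degree $k$ component of $R$ in the inherited grading, that is, the image in $R$ of the space of homogeneous elements of degree $k$. -/

import Mathlib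

/-- The space of homogeneous elements of degree `k` of the free algebra `K⟨X⟩`, where every
generator has degree `1`: the linear span of the words of length `k` in the alphabet `X`. -/
def freeHomogeneous (K X : Type*) [Field K] (k : ℕ) : Submodule K (FreeAlgebra K X) :=
  Submodule.span K (Set.range fun w : Fin k → X => (List.ofFn fun i => FreeAlgebra.ι K (w i)).prod)

/-- The `K`-algebra given by the generators `X` and the relations `r i = 0`: the quotient of the
free algebra `K⟨X⟩` by the two-sided ideal generated by the `r i`. -/
abbrev PresentedAlgebra {K X ι : Type*} [Field K] (r : ι → FreeAlgebra K X) :=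
  RingQuot fun a b : FreeAlgebra K X => ∃ i, a = r i ∧ b = 0

/-- The component `R_k` of the algebra `R` with generators `X` and relations `r`, in the grading
inherited from `K⟨X⟩`: the image of the homogeneous elements of degree `k`. -/
def PresentedAlgebra.component {K X ι : Type*} [Field K] (r : ι → FreeAlgebra K X) (k : ℕ) :
    Submodule K (PresentedAlgebra r) :=
  (freeHomogeneous K X k).map (RingQuot.mkAlgHom K _).toLinearMap

/-- The algebra given by the generators `X` and the relations `r` is quadratic: every relation is
homogeneous of degree `2`. -/
def IsQuadraticPresentation {K X ι : Type*} [Field K] (r : ι → FreeAlgebra K X) : Prop :=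
  ∀ i, r i ∈ freeHomogeneous K X 2

/-- The algebra `R` with generators `X` and relations `r` is `k`-step nilpotent: `R_k = 0`. -/
def IsStepNilpotent {K X ι : Type*} [Field K] (r : ι → FreeAlgebra K X) (k : ℕ) : Prop :=
  PresentedAlgebra.component r k = ⊥

/-! Everything reduces to one small algebra on five letters a, b, c, p, q. The core is the case of
three generators and three relations, bb = -ac, bc = cc - e·aa, ca = e·ab with e = ±1.

Blow-up. Write n = 3m + t with t < 3. Replace a, b, c by letters a_w, b_w, c_w for m labels w, and
each core relation by its m² labelled versions, for instance b_w b_w' = -a_w c_w'. All terms of a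
relation carry the same labels in the same order, so a computation in the core can be repeated with
labels attached: labels never interact. The t remaining letters (q first, then p) have no label.
Each of them has two relations with every label and one relation more. The total is 3m² + 2mt + t =
⌈n²/3⌉. To make the labels disappear, a labelled letter acts on functions of a list of labels by
consuming the first label (`labelled`), an unlabelled one by left multiplication (`unlabelled`).
These operators satisfy the label-free relations `TwistedRelations` (`twistedRelations`), and a word
of length five in the generators is recovered from an operator word by evaluating at its list of
labels (`five_mul_eq_zero`).

The label-free algebra. The nine relations are read as rewriting rules and completed up to length
five, as for a noncommutative Gröbner basis: an overlap of two left-hand sides is reduced in two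
ways, and the difference yields a new rule. Up to length four all leading coefficients can be made
1. In length five, a few words are left that satisfy only integral linear relations. The number of
letters p, q is preserved by every relation, which splits these relations into four systems: no p or
q, one p, one q, two letters from p, q. Solving them kills all words of length five (`apply_five`).

Characteristic. The first three systems have to be inverted, which costs an integer that depends on
e. The integers for e = 1 and e = -1 are coprime, so in every field at least one sign works
(`exists_isRegularSign`).

Linear independence. Each relation has a leading word that occurs in no other relation, so the
functionals reading off these coefficients form a dual family (`pairCoeff_lead`). -/

/-- Nine quadratic relations, depending on a sign `e`, between additive endomorphisms
`a`, `b`, `c`, `p`, `q`. The field `regular` excludes the characteristics in which they do not force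
all words of length five to vanish. -/
structure TwistedRelations {M : Type*} [AddCommGroup M] (e : ℤ) (a b c p q : M →+ M) : Prop where
  bb (t : M) : b (b t) = -a (c t)
  bc (t : M) : b (c t) = c (c t) - e • a (a t)
  ca (t : M) : c (a t) = e • a (b t)
  pb (t : M) : p (b t) = b (p t) - c (p t) + e • a (p t)
  pc (t : M) : p (c t) = b (p t)
  bq (t : M) : b (q t) = c (q t) + q (b t) + q (a t)
  aq (t : M) : a (q t) = -(e • q (c t)) - e • q (a t)
  pq (t : M) : p (q t) = q (q t)
  pp (t : M) : p (p t) = q (p t) + q (q t)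
  regular : (e = 1 ∧ ∀ x : M, (127 * 64673 * 661715 : ℤ) • x = 0 → x = 0) ∨
    (e = -1 ∧ ∀ x : M, (81 * 1133 * 653 : ℤ) • x = 0 → x = 0)

/-! ### Rewriting rules

The relations are completed to a system of rewriting rules. The rule for a word is named by that
word. The prefix `ech` marks a rule whose right-hand side is not yet fully reduced, `pre` and `nf`
mark the normal form of a word that is not the left-hand side of a rule, and `res` a relation
between words of length five that are not reducible by a rule with coefficient `1`. -/

namespace TwistedRelations

variable {M : Type*} [AddCommGroup M] {e : ℤ} {a b c p q : M →+ M}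
  (h : TwistedRelations e a b c p q) (t : M)
include h

/-- All identities below use e only through e² = 1. They are verified by `module` for the two values
of e separately. -/
theorem sign : e = 1 ∨ e = -1 :=
  h.regular.imp And.left And.left

/-! ### Rules of length three -/

theorem qqq : q (q (q t)) = 0 := by
  -- The pattern for all new rules: `H` contracts the overlap word, here ppq, at its left end, while
  -- `simp` rewrites inner words first and so contracts the other side at the right end. Here the
  -- result is qqq = 2·qqq.
  have H := h.pp (q t)
  simp only [h.pq] at H
  rcases h.sign with rfl | rfl <;> linear_combination (norm := module) -H

theorem pab : p (a (b t)) = e • b (p (a t)) := by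
  have H := h.pc (a t)
  simp only [map_zsmul, h.ca] at H
  -- The overlap gives the wanted word with coefficient ±e. Multiplying by e clears it since e² = 1;
  -- `e` is substituted only inside `norm`, so that it is still available as a multiplier.
  rcases h.sign with he | he <;> linear_combination (norm := (subst he; module)) e • H

theorem bac : b (a (c t)) = a (c (b t)) := by
  have H := h.bb (b t)
  simp only [map_neg, h.bb] at H
  rcases h.sign with rfl | rfl <;> linear_combination (norm := module) -H

theorem qqp : q (q (p t)) = 0 := by
  have H := h.pp (p t)
  simp only [map_add, h.pp, h.pq] at H
  rcases h.sign with rfl | rfl <;> linear_combination (norm := module) -H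

theorem bab : b (a (b t)) = -(e • a (a (c t))) - a (a (a t)) := by
  have H := h.bc (a t)
  simp only [map_neg, map_zsmul, h.bb, h.ca] at H
  rcases h.sign with he | he <;> linear_combination (norm := (subst he; module)) e • H

theorem paa : p (a (a t)) = e • c (b (p t)) - a (b (p t)) := by
  have H := h.pb (c t)
  simp only [map_sub, map_zsmul, h.bb, h.bc, h.pc] at H
  rcases h.sign with he | he <;> linear_combination (norm := (subst he; module)) -(e • H)

theorem baa : b (a (a t)) = e • a (c (c t)) + e • c (c (c t)) - a (a (c t)) := by
  have H := h.bb (c t)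
  simp only [map_sub, map_zsmul, h.bc] at H
  rcases h.sign with he | he <;> linear_combination (norm := (subst he; module)) -(e • H)

theorem cqc : c (q (c t)) = e • q (c (b t)) + (1 + e) • q (a (b t)) + e • q (a (a t)) - a (c (q
    t)) - c (q (a t)) := by
  have H := h.ca (q t)
  simp only [map_add, map_sub, map_neg, map_zsmul, h.aq, h.bq, h.ca] at H
  rcases h.sign with he | he <;> linear_combination (norm := (subst he; module)) -(e • H)

theorem pre_pbp : p (b (p t)) = q (b (p t)) + q (q (b t)) + q (q (a t)) - q (c (p t)) := by
  simp only [map_add, map_sub, map_neg, map_zsmul, h.aq, h.bq, h.pb, h.pp]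
  rcases h.sign with rfl | rfl <;> module

theorem qcp : q (c (p t)) = q (q (b t)) + q (q (a t)) - q (q (c t)) := by
  have H := h.pp (c t)
  simp only [h.pc, h.pre_pbp t] at H
  rcases h.sign with rfl | rfl <;> linear_combination (norm := module) -H

theorem pac : p (a (c t)) = (1 + e) • a (c (p t)) + c (b (p t)) + (1 - e) • a (b (p t)) - (1 + e)
    • a (a (p t)) - e • b (a (p t)) := by
  have H := h.pb (b t)
  simp only [map_add, map_sub, map_neg, map_zsmul, h.bb, h.bc, h.ca, h.pb] at H
  rcases h.sign with rfl | rfl <;> linear_combination (norm := module) -H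

theorem cqq : c (q (q t)) = e • q (q (c t)) - (1 - e) • q (q (a t)) - q (c (q t)) - q (q (b t)) :=
    by
  have H := h.pb (q t)
  simp only [map_add, map_sub, map_neg, map_zsmul, h.aq, h.bq, h.pc, h.pq] at H
  rcases h.sign with rfl | rfl <;> linear_combination (norm := module) H

theorem pap : p (a (p t)) = (1 + e) • q (a (p t)) + e • c (q (p t)) + e • q (b (p t)) - e • q (q
    (a t)) := by
  have H := h.pp (b t)
  simp only [map_add, map_sub, map_neg, map_zsmul, h.aq, h.bq, h.pb t, h.pc, h.pp, h.pre_pbp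
    t] at H
  rcases h.sign with he | he <;> linear_combination (norm := (subst he; module)) e • H + e • h.cqq
    t

theorem ccq : c (c (q t)) = e • q (c (c t)) + (1 + e) • q (a (c t)) - a (c (q t)) - (1 - e) • q (a
    (a t)) - c (q (b t)) - c (q (a t)) - q (b (a t)) := by
  have H := h.bb (q t)
  simp only [map_add, map_sub, map_neg, map_zsmul, h.aq, h.bb, h.bc, h.bq, h.ca] at H
  rcases h.sign with rfl | rfl <;> linear_combination (norm := module) H

/-! ### Rules of length four -/

theorem qqbp : q (q (b (p t))) = 0 := by
  have H := h.qqp (c t)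
  simp only [h.pc] at H
  rcases h.sign with rfl | rfl <;> linear_combination (norm := module) H

theorem qqcq : q (q (c (q t))) = 0 := by
  have H := h.pc (q (q t))
  simp only [map_sub, map_zsmul, map_zero, h.pq, h.cqq, h.qqq] at H
  rcases h.sign with rfl | rfl <;> linear_combination (norm := module) -H

theorem qqap : q (q (a (p t))) = 0 := by
  have H := h.qqp (b t)
  simp only [map_add, map_sub, map_zsmul, h.pb, h.qcp, h.qqq] at H
  rcases h.sign with he | he <;> linear_combination (norm := (subst he; module)) e • H - e •
    h.qqbp t

theorem qcqp : q (c (q (p t))) = 0 := by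
  have H := h.aq (q (p t))
  simp only [map_add, map_sub, map_neg, map_zsmul, map_zero, h.aq, h.qcp, h.qqp, h.qqq] at H
  rcases h.sign with he | he <;> linear_combination (norm := (subst he; module)) e • H + e •
    h.qqap t

theorem qcbp : q (c (b (p t))) = q (q (a (c t))) - e • q (q (a (a t))) := by
  have H := h.qcp (c t)
  simp only [map_sub, map_zsmul, h.bc, h.pc] at H
  rcases h.sign with rfl | rfl <;> linear_combination (norm := module) H

theorem cccb : c (c (c (b t))) = a (c (b (a t))) + e • a (a (c (b t))) - a (c (c (b t))) := by
  have H := h.bac (a t)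
  simp only [map_zsmul, h.ca, h.baa] at H
  rcases h.sign with rfl | rfl <;> linear_combination (norm := module) H

theorem acpa : a (c (p (a t))) = e • a (a (a (p t))) + a (a (c (p t))) - a (c (c (p t))) := by
  have H := h.pab (b t)
  simp only [map_sub, map_neg, map_zsmul, h.bb, h.bc, h.ca, h.pc, h.paa, h.pab] at H
  rcases h.sign with rfl | rfl <;> linear_combination (norm := module) H

theorem ech_cccc : c (c (c (c t))) = a (a (c (b t))) + e • a (a (a (b t))) + e • a (a (c (c t))) -
    a (c (c (c t))) := by
  have H := h.bab (b t)
  simp only [map_neg, h.bb, h.baa] at H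
  rcases h.sign with he | he <;> linear_combination (norm := (subst he; module)) -(e • H)

theorem cqab : c (q (a (b t))) = q (c (b (a t))) + (1 + e) • q (a (b (a t))) + q (a (a (a t))) - e
    • a (c (q (a t))) - e • c (q (a (a t))) := by
  have H := h.cqc (a t)
  simp only [map_zsmul, h.ca] at H
  rcases h.sign with he | he <;> linear_combination (norm := (subst he; module)) e • H

theorem accc : a (c (c (c t))) = a (a (b (a t))) - e • a (a (c (c t))) - 2 • a (a (a (c t))) - e •
    a (a (c (b t))) - a (a (a (b t))) := by
  have H := h.bab (c t)
  simp only [map_sub, map_neg, map_zsmul, h.bb, h.bc, h.ca, h.baa, h.bac] at H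
  rcases h.sign with rfl | rfl <;> linear_combination (norm := module) H

theorem qccp : q (c (c (p t))) = q (q (c (b t))) + 2 • q (q (a (c t))) + q (a (b (p t))) - q (q (a
    (b t))) - e • q (q (a (a t))) := by
  have H := h.qcp (b t)
  simp only [map_add, map_sub, map_neg, map_zsmul, h.bb, h.ca, h.pb] at H
  rcases h.sign with rfl | rfl <;> linear_combination (norm := module) -H + h.qcbp t

theorem ech_bapa : b (a (p (a t))) = e • c (b (p (a t))) + e • c (c (c (p t))) + e • a (a (c (p
    t))) + (1 + e) • a (a (a (p t))) - (1 + e) • a (a (p (a t))) - (1 - e) • a (b (p (a t))) - c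
    (b (a (p t))) - (1 + e) • a (c (c (p t))) := by
  have H := h.pac (a t)
  simp only [map_add, map_sub, map_neg, map_zsmul, h.bb, h.bc, h.ca, h.pb, h.paa] at H
  rcases h.sign with he | he <;> linear_combination (norm := (subst he; module)) e • H + (1 + e) •
    h.acpa t

theorem cbpa : c (b (p (a t))) = a (c (c (p t))) + (1 + e) • c (c (c (p t))) + (2 * e) • a (a (a
    (p t))) + e • a (b (p (a t))) - e • a (a (c (p t))) - (2 * e) • a (a (b (p t))) - e • c (c (b
    (p t))) := by
  have H := h.pab (c t)
  simp only [map_add, map_sub, map_neg, map_zsmul, h.bb, h.bc, h.ca, h.pc, h.baa, h.bab, h.bac,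
    h.paa, h.pac] at H
  rcases h.sign with rfl | rfl <;> linear_combination (norm := module) -H

theorem ech_qcqb : q (c (q (b t))) = q (a (c (p t))) + (1 + 2 * e) • q (q (c (b t))) + (1 + 2 * e)
    • q (q (a (b t))) + e • q (q (a (a t))) + (2 - e) • q (q (a (c t))) + q (a (b (p t))) - q (a
    (c (q t))) - 2 • q (c (q (a t))) - e • q (q (c (c t))) := by
  have H := h.aq (c (p t))
  simp only [map_add, map_sub, map_neg, map_zsmul, h.aq, h.ca, h.cqc, h.qcp] at H
  rcases h.sign with he | he <;> linear_combination (norm := (subst he; module)) -(e • H) + h.qccp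
    t

theorem ech_cqap : c (q (a (p t))) = (2 + e) • q (a (b (p t))) + e • q (a (a (p t))) + e • q (q (a
    (c t))) + q (q (c (b t))) + q (q (b (a t))) + q (a (c (p t))) - a (c (q (p t))) - q (q (c (c
    t))) := by
  have H := h.cqc (p t)
  simp only [map_add, map_sub, map_neg, map_zsmul, h.bb, h.bc, h.ca, h.cqc, h.cqq, h.qcp] at H
  rcases h.sign with he | he <;> linear_combination (norm := (subst he; module)) H + e • h.qcbp t
    + h.ech_qcqb t

/-- In fact bqq = 0: expanding by `bq` gives cqq + qbq + qaq, and by `cqq`, `bq` and `aq` all terms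
cancel. The last letter c plays no role, and the vanishing in `nf_bqqb`, `nf_bqqa` and their longer
variants has the same cause. -/
theorem pre_bqqc : b (q (q (c t))) = 0 := by
  simp only [map_add, map_sub, map_neg, map_zsmul, h.aq, h.bc, h.bq, h.cqc, h.cqq]
  rcases h.sign with rfl | rfl <;> module

theorem ech_qaap : q (a (a (p t))) = (2 * e) • q (q (a (c t))) + e • q (q (c (c t))) - e • q (q (a
    (b t))) - (1 + e) • q (q (a (a t))) - e • q (q (b (a t))) := by
  have H := h.bq (c (p t))
  simp only [map_add, map_sub, map_neg, map_zsmul, h.aq, h.bb, h.bc, h.bq (a t), h.bq (b t), h.bq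
    (q (a t)), h.bq (q (b t)), h.ca, h.cqc, h.cqq, h.qcp, h.pre_bqqc t] at H
  rcases h.sign with he | he <;> linear_combination (norm := (subst he; module)) e • H + e •
    h.qccp t - e • h.ech_qcqb t

theorem pre_pabp : p (a (b (p t))) = e • c (q (a (p t))) + e • q (b (a (p t))) + e • q (a (a (p
    t))) + e • q (c (c (p t))) + e • q (a (c (p t))) + 2 • q (q (c (b t))) + (2 + 2 * e) • q (q (a
    (b t))) + 2 • q (q (a (a t))) - a (c (q (p t))) - e • q (a (c (q t))) - (2 * e) • q (c (q (a
    t))) - q (q (c (c t))) - q (q (a (c t))) - e • q (c (q (b t))) := by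
  simp only [map_add, map_sub, map_neg, map_zsmul, h.aq, h.bb, h.bc, h.bq, h.ca, h.ccq, h.cqc,
    h.cqq, h.pab, h.pap, h.qcp]
  rcases h.sign with rfl | rfl <;> module

theorem ech_cqbp : c (q (b (p t))) = q (a (b (p t))) + (3 + 3 * e) • q (q (a (c t))) + 2 • q (a (c
    (p t))) + q (b (a (p t))) + q (q (c (b t))) + e • q (q (c (c t))) - (1 + e) • a (c (q (p t)))
    - e • q (q (b (a t))) - (1 + e) • q (q (a (b t))) - (2 + 2 * e) • q (q (a (a t))) := by
  have H := h.pap (c t)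
  simp only [map_neg, h.bb, h.pc, h.pre_pabp t] at H
  rcases h.sign with he | he <;> linear_combination (norm := (subst he; module)) -(e • H) + h.qccp
    t - h.ech_qcqb t + h.ech_cqap t + (1 + e) • h.ech_qaap t

theorem pre_bacq : b (a (c (q t))) = (2 * e) • q (a (a (a t))) + q (a (b (a t))) + e • q (c (b (a
    t))) - a (a (c (q t))) - q (c (c (c t))) - (2 + e) • q (a (c (c t))) - (1 + e) • q (a (a (c
    t))) := by
  simp only [map_add, map_sub, map_zsmul, h.aq, h.bc, h.bq, h.ca, h.bac, h.ccq]
  rcases h.sign with rfl | rfl <;> module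

theorem ech_acqb : a (c (q (b t))) = (1 + 2 * e) • q (c (c (c t))) + (1 + 4 * e) • q (a (c (c t)))
    + (1 + 2 * e) • q (a (a (b t))) + q (c (c (b t))) + q (a (c (b t))) + (1 + e) • q (a (b (a
    t))) - (1 - e) • a (a (c (q t))) - (2 - e) • q (a (a (a t))) - (2 + e) • q (a (a (c t))) - (1
    - e) • q (c (b (a t))) - a (c (q (a t))) := by
  have H := h.bab (q t)
  simp only [map_add, map_sub, map_neg, map_zsmul, h.aq, h.bb, h.bc, h.bq, h.ca, h.baa, h.bab,
    h.cqc, h.pre_bacq t] at H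
  rcases h.sign with he | he <;> linear_combination (norm := (subst he; module)) e • H + e •
    h.cqab t

theorem pre_cacq : c (a (c (q t))) = 2 • q (a (a (a t))) + (1 + e) • q (a (b (a t))) + q (c (b (a
    t))) + q (a (a (b t))) - e • a (a (c (q t))) - e • q (a (c (c t))) - (1 + e) • q (a (a (c t)))
    - e • a (c (q (b t))) - e • a (c (q (a t))) := by
  simp only [map_add, map_sub, map_neg, map_zsmul, h.aq, h.bb, h.bc, h.ca, h.ccq]
  rcases h.sign with rfl | rfl <;> module

theorem ech_cqba : c (q (b (a t))) = e • q (a (b (a t))) + (2 * e) • q (a (a (a t))) + (1 + e) • q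
    (a (a (b t))) - e • q (a (a (c t))) - q (a (c (b t))) - e • a (a (c (q t))) - a (c (q (a t)))
    - (1 - e) • c (q (a (a t))) - e • q (a (c (c t))) - e • q (c (c (c t))) := by
  have H := h.ccq (c t)
  simp only [map_add, map_sub, map_neg, map_zsmul, h.aq, h.bb, h.bc, h.ca t, h.ca (a t), h.ca (b
    t), h.ca (c t), h.baa, h.bac, h.ccq, h.cqc, h.pre_cacq t] at H
  rcases h.sign with rfl | rfl <;> linear_combination (norm := module) H - h.cqab t

theorem pre_bqcc : b (q (c (c t))) = a (a (c (q t))) + q (c (c (b t))) + q (a (c (b t))) + (1 + e)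
    • q (a (a (b t))) + a (c (q (a t))) + (1 + e) • q (c (c (c t))) + (2 + e) • q (a (c (c t))) -
    (1 + e) • q (a (a (c t))) - e • q (a (a (a t))) - c (q (a (c t))) := by
  simp only [map_add, map_sub, map_neg, map_zsmul, h.aq, h.bb, h.bc, h.bq, h.ca, h.cqc]
  rcases h.sign with rfl | rfl <;> module

theorem aacq : a (a (c (q t))) = q (c (c (c t))) + (1 + e) • q (a (c (c t))) + e • q (a (b (a t)))
    - 2 • q (a (a (a t))) - (1 + e) • q (a (a (c t))) - q (a (a (b t))) - (1 + e) • q (a (c (b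
    t))) := by
  have H := h.baa (q t)
  simp only [map_add, map_sub, map_neg, map_zsmul, h.aq, h.bb, h.bc, h.bq (a (a t)), h.bq (a (b
    t)), h.bq (a (c t)), h.ca t, h.ca (a t), h.ca (b t), h.ca (c t), h.baa, h.bab, h.bac, h.ccq,
    h.cqc, h.pre_bqcc t, h.pre_cacq t] at H
  rcases h.sign with rfl | rfl <;> linear_combination (norm := module) H + h.ech_acqb t

theorem pre_cqcq : c (q (c (q t))) = (1 - e) • q (q (a (c t))) + e • q (a (c (q t))) + (1 - e) • q
    (q (c (c t))) + (1 - e) • q (q (a (a t))) - q (q (c (b t))) - q (q (a (b t))) - e • q (q (b (a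
    t))) := by
  simp only [map_add, map_sub, map_neg, map_zsmul, h.aq, h.bc, h.bq, h.ca, h.ccq, h.cqc, h.cqq]
  rcases h.sign with rfl | rfl <;> module

theorem pre_bqcq : b (q (c (q t))) = (2 - e) • q (q (a (c t))) + e • q (a (c (q t))) + (1 - e) • q
    (q (c (c t))) - q (q (c (b t))) - 2 • q (q (a (b t))) - e • q (q (a (a t))) - (1 + e) • q (q
    (b (a t))) - q (c (q (b t))) - q (c (q (a t))) := by
  simp only [map_add, map_sub, map_neg, map_zsmul, h.aq, h.bc, h.bq, h.ca, h.ccq, h.pre_cqcq t]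
  rcases h.sign with rfl | rfl <;> module

theorem pre_pacq : p (a (c (q t))) = e • q (c (q (b t))) + e • q (c (q (a t))) + (2 - e) • q (q (a
    (c t))) + e • q (a (c (q t))) + (1 - e) • q (q (c (c t))) - (4 + 2 * e) • q (q (a (b t))) - (2
    + e) • q (q (c (b t))) - (1 + 2 * e) • q (q (a (a t))) - (1 + e) • q (q (b (a t))) := by
  simp only [map_add, map_sub, map_neg, map_zsmul, h.aq, h.bb, h.bc, h.bq t, h.bq (a t), h.bq (q
    t), h.bq (q (a t)), h.ca, h.pq, h.ccq, h.cqc t, h.cqq, h.pac, h.pre_bqcq t, h.pre_bqqc t,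
    h.pre_cqcq t]
  rcases h.sign with rfl | rfl <;> module

theorem ech_qcqa : q (c (q (a t))) = (1 + e) • q (q (a (c t))) + q (a (c (p t))) + q (a (b (p t)))
    - (2 + 3 * e) • q (q (a (b t))) - q (q (c (b t))) - 3 • q (q (a (a t))) - q (q (c (c t))) - (1
    + e) • q (q (b (a t))) := by
  have H := h.pc (q (c t))
  simp only [map_add, map_sub, map_neg, map_zsmul, h.aq, h.bq (a t), h.bq (q (a t)), h.ca, h.pc,
    h.pq, h.cqc, h.cqq, h.pre_bqqc t, h.pre_pacq t] at H
  rcases h.sign with he | he <;> linear_combination (norm := (subst he; module)) e • H +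
    h.ech_qcqb t

theorem ech_qacq : q (a (c (q t))) = (1 + 2 * e) • q (q (c (b t))) + (3 + 3 * e) • q (q (a (b t)))
    + (1 + 2 * e) • q (q (a (a t))) + (1 + e) • q (q (b (a t))) - (2 + 2 * e) • q (q (a (c t))) -
    (1 + e) • q (q (c (c t))) := by
  have H := h.bc (q (q t))
  simp only [map_add, map_sub, map_neg, map_zsmul, h.aq, h.bb, h.bc, h.bq (a t), h.bq (b t), h.bq
    (q (a t)), h.bq (q (b t)), h.ca, h.ccq, h.cqc t, h.cqq, h.pre_bqcq t, h.pre_bqqc t, h.pre_cqcq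
    t] at H
  rcases h.sign with he | he <;> linear_combination (norm := (subst he; module)) H + e •
    h.ech_qcqb t - e • h.ech_qcqa t

/-- With `qqba` and `acqp` below, this closes the triangular system formed by the preceding `ech`
relations between words with two letters from p, q. -/
theorem qqcc : q (q (c (c t))) = -q (q (a (c t))) - e • q (q (a (b t))) - q (q (a (a t))) := by
  have H := h.paa (q t)
  simp only [map_add, map_sub, map_neg, map_zsmul, h.aq, h.bb, h.bc, h.bq, h.ca, h.pq, h.ccq,
    h.cqc t, h.cqq, h.pre_cqcq t] at H
  rcases h.sign with rfl | rfl <;> linear_combination (norm := module) H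

theorem qqba : q (q (b (a t))) = q (q (a (c t))) - (2 + e) • q (q (a (b t))) - (1 + e) • q (q (a
    (a t))) - e • q (q (c (b t))) := by
  have H := h.pc (c (q t))
  simp only [map_add, map_sub, map_neg, map_zsmul, h.aq, h.bb, h.bq t, h.bq (a t), h.bq (b t),
    h.bq (q t), h.bq (q (a t)), h.bq (q (b t)), h.ca, h.pc, h.pq, h.ccq, h.cqq, h.pre_bqcq t,
    h.pre_bqqc t, h.pre_pacq t] at H
  rcases h.sign with he | he <;> linear_combination (norm := (subst he; module)) -H - e •
    h.ech_qcqb t + e • h.ech_qcqa t + e • h.qqcc t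

theorem pre_paap : p (a (a (p t))) = q (c (c (p t))) + (1 + e) • q (a (c (p t))) + q (a (a (p t)))
    + e • q (c (b (p t))) + (1 + e) • q (a (b (p t))) - (1 + e) • a (c (q (p t))) - e • q (b (a (p
    t))) := by
  simp only [map_add, map_sub, map_neg, map_zsmul, h.aq, h.bb, h.bc, h.bq, h.ca, h.pp, h.ccq,
    h.cqc t, h.cqq, h.paa, h.pre_cqcq t]
  rcases h.sign with rfl | rfl <;> module

theorem pre_pacp : p (a (c (p t))) = a (c (q (p t))) + (2 * e) • q (q (a (b t))) + (1 - 2 * e) • q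
    (q (a (c t))) + e • q (q (c (b t))) + q (q (a (a t))) + c (q (a (p t))) + e • q (c (c (p t)))
    + (1 + e) • q (a (c (p t))) + (1 - e) • q (c (b (p t))) - (2 * e) • q (q (c (c t))) - q (a (c
    (q t))) - (2 + e) • q (c (q (a t))) - (1 + e) • q (a (b (p t))) - e • q (a (a (p t))) - (1 +
    e) • q (q (b (a t))) - q (c (q (b t))) := by
  simp only [map_add, map_sub, map_neg, map_zsmul, h.aq, h.bb, h.bc, h.bq t, h.bq (a t), h.bq (b
    t), h.bq (p t), h.bq (q t), h.bq (a (p t)), h.bq (q (a t)), h.bq (q (b t)), h.ca, h.pp, h.ccq,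
    h.cqc t, h.cqq, h.pac, h.qcp, h.pre_bqcq t, h.pre_bqqc t, h.pre_cqcq t]
  rcases h.sign with rfl | rfl <;> module

theorem acqp : a (c (q (p t))) = (1 - 2 * e) • q (q (c (b t))) + (1 - e) • q (a (b (p t))) + q (a
    (c (p t))) + (1 - e) • q (q (a (a t))) - (2 - e) • q (q (a (b t))) - (2 * e) • q (q (a (c t)))
    - (2 * e) • q (b (a (p t))) := by
  have H := h.pap (b t)
  simp only [map_add, map_sub, map_neg, map_zsmul, h.bb, h.bc, h.ca, h.pb, h.cqc, h.cqq, h.qcp,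
    h.pre_paap t, h.pre_pabp t, h.pre_pacp t] at H
  rcases h.sign with he | he <;> linear_combination (norm := (subst he; module)) -(e • H) + h.qcbp
    t + (2 : ℤ) • h.qccp t - (2 - e) • h.ech_qcqb t + (1 - 2 * e) • h.ech_cqap t - e • h.ech_qaap
    t - h.ech_cqbp t + h.ech_qcqa t - (1 - e) • h.qqcc t + (1 - e) • h.qqba t

/-- From here to `bapa` the `ech` relations are back-substituted, so that their right-hand sides
become irreducible. -/
theorem qaap : q (a (a (p t))) = e • q (q (a (b t))) + q (q (c (b t))) - e • q (q (a (a t))) := by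
  rcases h.sign with he | he <;> linear_combination (norm := (subst he; module)) h.ech_qaap t + e
    • h.qqcc t - e • h.qqba t

theorem qacq : q (a (c (q t))) = e • q (q (c (b t))) + (1 + e) • q (q (a (b t))) + e • q (q (a (a
    t))) := by
  rcases h.sign with he | he <;> linear_combination (norm := (subst he; module)) h.ech_qacq t - (1
    + e) • h.qqcc t + (1 + e) • h.qqba t

theorem qcqa : q (c (q (a t))) = (1 + e) • q (q (a (b t))) + e • q (q (c (b t))) + (2 * e) • q (q
    (a (a t))) + q (q (a (c t))) + q (a (c (p t))) + q (a (b (p t))) := by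
  rcases h.sign with he | he <;> linear_combination (norm := (subst he; module)) h.ech_qcqa t -
    h.qqcc t - (1 + e) • h.qqba t

theorem qcqb : q (c (q (b t))) = (1 - e) • q (q (c (b t))) - q (a (c (p t))) - (1 + e) • q (q (a
    (b t))) - q (a (b (p t))) - (3 * e) • q (q (a (a t))) := by
  rcases h.sign with he | he <;> linear_combination (norm := (subst he; module)) h.ech_qcqb t -
    h.qacq t - (2 : ℤ) • h.qcqa t - e • h.qqcc t

theorem acqb : a (c (q (b t))) = (3 * e) • q (c (c (c t))) + (1 + 4 * e) • q (a (c (c t))) + (2 +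
    e) • q (a (a (b t))) + q (c (c (b t))) + q (a (c (b t))) + 2 • q (a (b (a t))) - e • q (a (a
    (a t))) - (2 + e) • q (a (a (c t))) - (1 - e) • q (c (b (a t))) - a (c (q (a t))) := by
  rcases h.sign with he | he <;> linear_combination (norm := (subst he; module)) h.ech_acqb t - (1
    - e) • h.aacq t

theorem cqap : c (q (a (p t))) = (1 + 2 * e) • q (a (b (p t))) + (2 + 3 * e) • q (q (a (c t))) +
    (2 * e) • q (q (c (b t))) + (1 - e) • q (q (a (b t))) + (2 * e) • q (b (a (p t))) - 2 • q (q
    (a (a t))) := by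
  rcases h.sign with he | he <;> linear_combination (norm := (subst he; module)) h.ech_cqap t -
    h.acqp t + e • h.qaap t - h.qqcc t + h.qqba t

theorem cqba : c (q (b (a t))) = q (a (a (c t))) + (4 * e) • q (a (a (a t))) + e • q (a (c (b t)))
    + (1 + 2 * e) • q (a (a (b t))) - (1 - e) • q (a (b (a t))) - a (c (q (a t))) - (1 - e) • c (q
    (a (a t))) - (1 + 2 * e) • q (a (c (c t))) - (2 * e) • q (c (c (c t))) := by
  rcases h.sign with he | he <;> linear_combination (norm := (subst he; module)) h.ech_cqba t - e
    • h.aacq t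

theorem cqbp : c (q (b (p t))) = q (a (b (p t))) + (5 + 3 * e) • q (q (a (c t))) + (1 - e) • q (a
    (c (p t))) + (3 + 2 * e) • q (b (a (p t))) + (3 + e) • q (q (c (b t))) + (2 * e) • q (q (a (b
    t))) - (1 + 2 * e) • q (q (a (a t))) := by
  rcases h.sign with he | he <;> linear_combination (norm := (subst he; module)) h.ech_cqbp t - (1
    + e) • h.acqp t + e • h.qqcc t - e • h.qqba t

theorem cccc : c (c (c (c t))) = (1 + e) • a (a (c (b t))) + (1 + e) • a (a (a (b t))) + (2 * e) •
    a (a (c (c t))) + 2 • a (a (a (c t))) - a (a (b (a t))) := by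
  rcases h.sign with rfl | rfl <;> linear_combination (norm := module) h.ech_cccc t - h.accc t

theorem bapa : b (a (p (a t))) = e • a (b (p (a t))) + (1 + 2 * e) • c (c (c (p t))) + (3 + e) • a
    (a (a (p t))) - (1 + e) • a (a (p (a t))) - c (b (a (p t))) - (1 - e) • a (a (c (p t))) - a (c
    (c (p t))) - 2 • a (a (b (p t))) - c (c (b (p t))) := by
  rcases h.sign with he | he <;> linear_combination (norm := (subst he; module)) h.ech_bapa t + e
    • h.cbpa t

/-! ### Rules of length five with leading coefficient 1 -/

theorem qqabp : q (q (a (b (p t)))) = 0 := by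
  have H := h.qqp (a (a t))
  simp only [map_sub, map_zsmul, h.paa, h.qqq, h.qcbp] at H
  rcases h.sign with rfl | rfl <;> linear_combination (norm := module) -H

theorem qqacp : q (q (a (c (p t)))) = 0 := by
  have H := h.qqbp (c t)
  simp only [map_neg, h.bb, h.pc] at H
  rcases h.sign with rfl | rfl <;> linear_combination (norm := module) -H

theorem nf_baacb : b (a (a (c (b t)))) = a (a (a (c (b t)))) + a (c (c (b (a t)))) + e • a (a (a
    (a (a t)))) - (1 - e) • a (a (c (b (a t)))) - e • a (a (c (c (b t)))) - e • a (a (a (b (a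
    t)))) - a (a (a (c (c t)))) := by
  simp only [map_add, map_sub, map_neg, map_zsmul, h.bb, h.bc, h.ca, h.baa, h.bac, h.cccb]
  rcases h.sign with rfl | rfl <;> module

theorem accba : a (c (c (b (a t)))) = (1 - e) • a (a (c (b (a t)))) + e • a (a (c (c (b t)))) + e
    • a (a (a (b (a t)))) - a (a (a (a (c t)))) - a (a (a (c (b t)))) := by
  have H := h.bab (a (c t))
  simp only [map_sub, map_zsmul, h.bc, h.ca, h.bac, h.nf_baacb t] at H
  rcases h.sign with rfl | rfl <;> linear_combination (norm := module) H

theorem accpa : a (c (c (p (a t)))) = e • a (a (a (p (a t)))) + a (a (c (c (p t)))) + a (a (c (b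
    (p t)))) := by
  have H := h.ca (c (p (a t)))
  simp only [map_add, map_sub, map_zsmul, h.bc, h.ca, h.baa, h.bac, h.accc, h.acpa] at H
  rcases h.sign with he | he <;> linear_combination (norm := (subst he; module)) -(e • H)

theorem nf_baac : b (a (a (c t))) = e • a (a (c (b t))) + a (a (a (b t))) := by
  simp only [h.baa, h.accc, h.cccc]
  rcases h.sign with rfl | rfl <;> module

theorem aaccb : a (a (c (c (b t)))) = (5 + e) • a (a (a (a (b t)))) + (2 - 2 * e) • a (a (a (a (c
    t)))) + (2 + e) • a (a (a (a (a t)))) + (1 + 2 * e) • a (a (c (b (a t)))) - (1 - 4 * e) • a (a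
    (a (c (b t)))) - a (a (a (c (c t)))) - e • a (a (a (b (a t)))) := by
  have H := h.cccb (c t)
  simp only [map_add, map_sub, map_neg, map_zsmul, map_nsmul, h.bb, h.bc, h.ca, h.baa (b t),
    h.bab, h.bac, h.accc, h.cccb, h.cccc, h.nf_baac t] at H
  rcases h.sign with he | he <;> linear_combination (norm := (subst he; module)) -(e • H)

theorem aacba : a (a (c (b (a t)))) = (1 - e) • a (a (a (c (c t)))) + (1 - e) • a (a (a (b (a
    t)))) + (1 - e) • a (a (a (c (b t)))) - (1 + e) • a (a (a (a (c t)))) - 3 • a (a (a (a (b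
    t)))) := by
  have H := h.accc (a t)
  simp only [map_add, map_sub, map_neg, map_zsmul, map_nsmul, h.bb, h.ca, h.baa, h.bac,
    h.accc] at H
  rcases h.sign with he | he <;> linear_combination (norm := (subst he; module)) e • H

theorem accbp : a (c (c (b (p t)))) = a (a (a (a (p t)))) - (2 * e) • a (a (c (c (p t)))) - (1 -
    e) • a (a (a (c (p t)))) - e • a (a (c (b (p t)))) := by
  have H := h.acpa (a t)
  simp only [map_add, map_sub, map_neg, map_zsmul, h.bb, h.ca, h.paa, h.acpa] at H
  rcases h.sign with he | he <;> linear_combination (norm := (subst he; module)) e • H - e •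
    h.accpa t

theorem nf_baacp : b (a (a (c (p t)))) = e • a (a (c (b (p t)))) + a (a (a (b (p t)))) := by
  simp only [h.baa, h.accc, h.cccc]
  rcases h.sign with rfl | rfl <;> module

theorem nf_paacb : p (a (a (c (b t)))) = e • a (a (a (b (p t)))) + a (a (b (a (p t)))) + (1 - e) •
    a (a (c (b (p t)))) + a (a (a (a (p t)))) - a (c (c (b (p t)))) - (1 + e) • a (a (c (c (p
    t)))) - 2 • a (a (a (c (p t)))) := by
  simp only [map_add, map_sub, map_neg, map_zsmul, h.bb, h.bc, h.ca, h.pb, h.pc, h.baa, h.bab,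
    h.bac, h.paa, h.accc, h.cccc]
  rcases h.sign with rfl | rfl <;> module

theorem aabap : a (a (b (a (p t)))) = (2 - e) • a (a (c (c (p t)))) + (1 + 2 * e) • a (a (a (c (p
    t)))) := by
  have H := h.pab (a (c t))
  simp only [map_sub, map_neg, map_zsmul, h.bb, h.bc, h.ca, h.pc, h.baa (a (p t)), h.bac, h.paa (c
    t), h.accc, h.nf_baacp t, h.nf_paacb t] at H
  rcases h.sign with rfl | rfl <;> linear_combination (norm := module) H + h.accbp t

theorem aaaba : a (a (a (b (a t)))) = (1 + 2 * e) • a (a (a (a (c t)))) + 3 • a (a (a (a (b t))))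
    - (1 - 2 * e) • a (a (a (c (c t)))) - a (a (a (c (b t)))) - a (a (a (a (a t)))) := by
  have H := h.cccc (a t)
  simp only [map_add, map_sub, map_neg, map_zsmul, map_nsmul, h.bb, h.bc, h.ca, h.baa, h.bac,
    h.accc] at H
  rcases h.sign with he | he <;> linear_combination (norm := (subst he; module)) -H - (1 + e) •
    h.aacba t

theorem aaacb : a (a (a (c (b t)))) = (3 - 5 * e) • a (a (a (a (c t)))) + (4 - e) • a (a (a (c (c
    t)))) + (1 - 2 * e) • a (a (a (a (a t)))) - (2 - 2 * e) • a (a (a (a (b t)))) := by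
  have H := h.accc (c t)
  simp only [map_add, map_sub, map_zsmul, map_nsmul, h.bc, h.ca, h.bac, h.accc, h.cccc] at H
  rcases h.sign with he | he <;> linear_combination (norm := (subst he; module)) -H - (1 - e) •
    h.aaaba t

theorem cqacc : c (q (a (c (c t)))) = e • q (a (c (c (b t)))) + (1 + e) • q (a (a (c (b t)))) + q
    (a (a (a (c t)))) + e • c (q (a (a (a t)))) - e • a (c (q (a (c t)))) - q (a (a (a (b t)))) -
    e • c (q (a (a (c t)))) := by
  have H := h.cqab (c t)
  simp only [map_sub, map_zsmul, h.bc, h.ca, h.bac] at H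
  rcases h.sign with rfl | rfl <;> linear_combination (norm := module) H

theorem qccbp : q (c (c (b (p t)))) = (1 + e) • q (q (a (a (a t)))) - q (q (a (b (a t)))) - e • q
    (q (a (c (c t)))) - (1 + e) • q (q (a (a (c t)))) - q (a (a (c (p t)))) := by
  have H := h.qcp (a (a t))
  simp only [map_add, map_sub, map_neg, map_zsmul, h.bb, h.bc, h.ca, h.baa, h.paa, h.qqcc] at H
  rcases h.sign with he | he <;> linear_combination (norm := (subst he; module)) e • H

theorem aabpa : a (a (b (p (a t)))) = (1 - 3 * e) • a (a (c (c (p t)))) + 2 • a (a (c (b (p t))))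
    + (3 + 2 * e) • a (a (a (b (p t)))) - (1 - e) • a (a (a (c (p t)))) - a (a (a (a (p t)))) :=
    by
  have H := h.bac (p (a t))
  simp only [map_add, map_sub, map_neg, map_zsmul, h.bb, h.bc, h.ca, h.baa (a (p t)), h.bac,
    h.accc, h.acpa, h.cbpa, h.nf_baacp t] at H
  rcases h.sign with he | he <;> linear_combination (norm := (subst he; module)) -(e • H) +
    h.accbp t - (1 + e) • h.aabap t

theorem cqacb : c (q (a (c (b t)))) = (2 + 2 * e) • q (a (a (a (c t)))) - 2 • q (a (a (c (b t))))
    - (1 + e) • q (a (a (a (b t)))) - a (c (q (a (c t)))) - (1 - 3 * e) • q (a (a (c (c t)))) - (2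
    + e) • q (a (a (a (a t)))) - (1 - e) • c (q (a (a (c t)))) - q (a (a (b (a t)))) := by
  have H := h.cqba (c t)
  simp only [map_add, map_sub, map_zsmul, map_nsmul, h.bc, h.ca, h.bac, h.accc, h.cccc] at H
  rcases h.sign with rfl | rfl <;> linear_combination (norm := module) H

theorem aaabp : a (a (a (b (p t)))) = -((2 + e) • a (a (c (b (p t))))) - 4 • a (a (c (c (p t)))) -
    (1 - e) • a (a (a (a (p t)))) - a (c (b (a (p t)))) - (2 + 4 * e) • a (a (a (c (p t)))) := by
  have H := h.acpa (c t)
  simp only [map_add, map_sub, map_neg, map_zsmul, h.bb, h.bc, h.ca, h.pc, h.pac] at H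
  rcases h.sign with he | he <;> linear_combination (norm := (subst he; module)) -(e • H) + (2 *
    e) • h.accbp t - (1 + e) • h.aabap t

theorem aaaap : a (a (a (a (p t)))) = (1 + e) • a (a (a (c (p t)))) + (2 + 2 * e) • a (a (c (b (p
    t)))) + (1 + 2 * e) • a (c (b (a (p t)))) + (3 + 4 * e) • a (a (c (c (p t)))) := by
  have H := h.bapa (c t)
  simp only [map_add, map_sub, map_neg, map_zsmul, h.bb, h.bc, h.ca, h.pc, h.baa (p t), h.baa (a
    (p t)), h.baa (b (p t)), h.bab, h.bac, h.pac, h.accc, h.cccb, h.nf_baacp t] at H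
  rcases h.sign with he | he <;> linear_combination (norm := (subst he; module)) e • H - (1 + 2 *
    e) • h.accbp t + e • h.aabap t

theorem ccbap : c (c (b (a (p t)))) = -((9 + 6 * e) • a (a (c (c (p t))))) - (10 + 8 * e) • a (a
    (a (c (p t)))) - (4 + 7 * e) • a (a (c (b (p t)))) - (4 + e) • a (c (b (a (p t)))) := by
  have H := h.cbpa (b t)
  simp only [map_add, map_sub, map_neg, map_zsmul, h.bb, h.bc, h.ca, h.pb, h.baa, h.bac, h.pab,
    h.accc, h.acpa, h.cccb, h.cccc] at H
  rcases h.sign with he | he <;> linear_combination (norm := (subst he; module)) H - e • h.accbp t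
    - (2 : ℤ) • h.aabap t + e • h.aaabp t + (1 - 3 * e) • h.aaaap t

theorem qaabp : q (a (a (b (p t)))) = -q (q (a (c (c t)))) - (1 + e) • q (q (a (a (c t)))) - q (q
    (a (b (a t)))) := by
  have H := h.qaap (c t)
  simp only [map_sub, map_zsmul, h.bc, h.ca, h.pc, h.qqcc] at H
  rcases h.sign with rfl | rfl <;> linear_combination (norm := module) H

theorem qcccp : q (c (c (c (p t)))) = e • q (q (a (a (b t)))) + q (a (a (a (p t)))) + q (a (b (a
    (p t)))) + e • q (c (b (a (p t)))) - q (q (a (c (b t)))) - e • q (a (c (c (p t)))) := by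
  have H := h.qcbp (b t)
  simp only [map_add, map_sub, map_neg, map_zsmul, h.bb, h.bc, h.ca, h.pb] at H
  rcases h.sign with rfl | rfl <;> linear_combination (norm := module) -H

theorem qaccp : q (a (c (c (p t)))) = q (q (a (a (c t)))) + e • q (a (a (a (p t)))) - e • q (q (a
    (c (c t)))) := by
  have H := h.qcbp (c t)
  simp only [map_sub, map_neg, map_zsmul, h.bb, h.bc, h.ca, h.pc] at H
  rcases h.sign with he | he <;> linear_combination (norm := (subst he; module)) -(e • H)

theorem nf_aacqa : a (a (c (q (a t)))) = (1 - e) • q (a (a (c (c t)))) - (2 * e) • q (a (a (c (b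
    t)))) - (3 + 2 * e) • q (a (a (a (c t)))) - 2 • q (a (a (a (a t)))) - (2 + e) • q (a (a (a (b
    t)))) - (1 + e) • q (a (c (b (a t)))) := by
  simp only [map_add, map_sub, map_neg, map_zsmul, map_nsmul, h.bb, h.ca, h.baa, h.bac, h.aacq,
    h.accc]
  rcases h.sign with rfl | rfl <;> module

theorem cqaab : c (q (a (a (b t)))) = e • q (c (c (b (a t)))) + (1 + e) • q (a (a (b (a t)))) + e
    • a (c (q (a (a t)))) + e • c (q (a (a (c t)))) - (2 + e) • q (a (a (c (b t)))) - (3 + 4 * e)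
    • q (a (a (a (c t)))) - (1 + 2 * e) • q (a (a (a (a t)))) - (2 + 2 * e) • q (a (a (a (b t))))
    - (1 - e) • q (a (a (c (c t)))) - q (a (c (b (a t)))) := by
  have H := h.cqab (b t)
  simp only [map_add, map_sub, map_neg, map_zsmul, map_nsmul, h.aq, h.bb, h.ca, h.baa, h.bab,
    h.bac, h.accc, h.cqab, h.nf_aacqa t] at H
  rcases h.sign with he | he <;> linear_combination (norm := (subst he; module)) e • H

theorem cqacp : c (q (a (c (p t)))) = (3 + 3 * e) • q (a (a (c (p t)))) + (3 + 2 * e) • q (a (a (a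
    (p t)))) + (4 + 3 * e) • q (q (a (a (c t)))) + (3 + e) • q (q (a (b (a t)))) - (1 + e) • q (q
    (a (c (c t)))) - (1 - e) • q (a (c (b (p t)))) - (1 + e) • q (q (a (a (a t)))) := by
  have H := h.cqbp (c t)
  simp only [map_sub, map_neg, map_zsmul, h.bb, h.bc, h.ca, h.pc, h.bab, h.qqcc] at H
  rcases h.sign with rfl | rfl <;> linear_combination (norm := module) -H

theorem cqaac : c (q (a (a (c t)))) = (3 + e) • q (a (a (c (b t)))) + (6 + 5 * e) • q (a (a (a (c
    t)))) + 2 • q (a (a (a (b t)))) + q (a (a (c (c t)))) + (3 * e) • q (a (c (b (a t)))) + q (a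
    (c (c (b t)))) - q (c (c (b (a t)))) - (1 + 2 * e) • q (a (a (b (a t)))) - a (c (q (a (a t))))
    - c (q (a (a (a t)))) := by
  have H := h.cqba (b t)
  simp only [map_add, map_sub, map_neg, map_zsmul, map_nsmul, h.aq, h.bb, h.bc, h.ca, h.baa,
    h.bab, h.accc, h.cccb, h.cqab, h.nf_aacqa t] at H
  rcases h.sign with he | he <;> linear_combination (norm := (subst he; module)) -H + (1 - e) •
    h.cqaab t

theorem acqac : a (c (q (a (c t)))) = (1 - 3 * e) • q (a (c (b (a t)))) + (3 * e) • q (a (a (c (b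
    t)))) + (6 + 7 * e) • q (a (a (a (c t)))) + (3 + 4 * e) • q (a (a (a (b t)))) + (1 + e) • q (a
    (a (a (a t)))) - (1 + e) • q (a (c (c (b t)))) - (1 - e) • q (a (a (c (c t)))) - (2 + e) • q
    (a (a (b (a t)))) - e • q (c (c (b (a t)))) - e • a (c (q (a (a t)))) := by
  have H := h.acqb (b t)
  simp only [map_add, map_sub, map_neg, map_zsmul, map_nsmul, h.aq, h.bb, h.bc, h.ca, h.baa,
    h.bab, h.bac, h.accc, h.cccb, h.cqab, h.nf_aacqa t] at H
  rcases h.sign with rfl | rfl <;> linear_combination (norm := module) -H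

theorem nf_cqcc : c (q (c (c t))) = (1 + e) • q (c (c (c t))) + (2 + 2 * e) • q (a (c (c t))) + e
    • q (a (b (a t))) + e • q (a (a (b t))) + q (c (c (b t))) + a (c (q (a t))) - (2 + e) • q (a
    (a (a t))) - (2 + e) • q (a (a (c t))) - e • q (a (c (b t))) - c (q (a (c t))) := by
  simp only [map_add, map_sub, map_neg, map_zsmul, h.aq, h.bb, h.bc, h.ca, h.cqc, h.aacq]
  rcases h.sign with rfl | rfl <;> module

theorem acqaa : a (c (q (a (a t)))) = (4 + 3 * e) • q (a (a (a (c t)))) + 5 • q (a (a (a (a t))))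
    + (2 - e) • q (a (c (c (b t)))) - (3 + e) • q (a (a (c (b t)))) - (1 + 7 * e) • q (a (a (a (b
    t)))) - (1 + 3 * e) • q (a (a (c (c t)))) - (1 + 2 * e) • q (a (a (b (a t)))) - (2 + e) • q (a
    (c (b (a t)))) := by
  have H := h.acqb (c t)
  simp only [map_add, map_sub, map_neg, map_zsmul, map_nsmul, h.aq, h.bb, h.bc, h.ca, h.baa,
    h.bab, h.bac, h.accc, h.cccb, h.cccc, h.nf_cqcc t, h.nf_aacqa t] at H
  rcases h.sign with he | he <;> linear_combination (norm := (subst he; module)) -(e • H)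

theorem qaccb : q (a (c (c (b t)))) = (2 + e) • q (a (c (b (a t)))) + e • q (a (a (a (b t)))) - (1
    - 3 * e) • q (a (a (c (c t)))) - (1 - 3 * e) • q (a (a (b (a t)))) - (2 + 3 * e) • q (a (a (c
    (b t)))) - (3 - 2 * e) • q (a (a (a (a t)))) - (1 + 2 * e) • q (a (a (a (c t)))) := by
  have H := h.aacq (c t)
  simp only [map_add, map_sub, map_neg, map_zsmul, map_nsmul, h.aq, h.bb, h.bc, h.ca, h.baa,
    h.bab, h.bac, h.cqc, h.aacq t, h.accc, h.cccb, h.cccc, h.nf_aacqa t] at H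
  rcases h.sign with he | he <;> linear_combination (norm := (subst he; module)) -(e • H)

theorem qqacb : q (q (a (c (b t)))) = (1 + e) • q (q (a (a (a t)))) + e • q (q (a (b (a t)))) - q
    (q (a (a (c t)))) := by
  have H := h.qqba (c t)
  simp only [map_sub, map_zsmul, h.bc, h.ca, h.bac, h.qqcc] at H
  rcases h.sign with rfl | rfl <;> linear_combination (norm := module) H

theorem qcbap : q (c (b (a (p t)))) = -(e • q (q (a (a (a t))))) - (1 + e) • q (a (b (a (p t)))) -
    q (a (a (c (p t)))) - (1 + e) • q (q (a (b (a t)))) - (1 + e) • q (q (a (c (c t)))) := by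
  have H := h.qcp (a (c t))
  simp only [map_add, map_sub, map_neg, map_zsmul, h.bb, h.bc, h.ca, h.bac, h.pac] at H
  rcases h.sign with he | he <;> linear_combination (norm := (subst he; module)) -(e • H) + e •
    h.qccbp t + (1 + e) • h.qaccp t - e • h.qqacb t

end TwistedRelations

namespace TwistedRelations

variable {M : Type*} [AddCommGroup M] {e : ℤ} {a b c p q : M →+ M}
  (h : TwistedRelations e a b c p q) (t : M)
include h

theorem aaapa : a (a (a (p (a t)))) = -((34 + 10 * e) • a (a (c (c (p t))))) - (9 + 27 * e) • a (a
    (a (c (p t)))) - (16 + 5 * e) • a (a (c (b (p t)))) - (4 + 11 * e) • a (c (b (a (p t)))) := by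
  have H := h.bc (b (p (a t)))
  simp only [map_add, map_sub, map_neg, map_zsmul, h.bb, h.bc, h.ca, h.baa (p t), h.baa (a (p t)),
    h.baa (b (p t)), h.bab, h.bac, h.accc, h.acpa, h.cbpa, h.cccb, h.cccc, h.nf_baacp t] at H
  rcases h.sign with he | he <;> linear_combination (norm := (subst he; module)) -(e • H) - (3 :
    ℤ) • h.aabap t + h.aabpa t + (5 - e) • h.aaabp t - (7 - 4 * e) • h.aaaap t

theorem qqaaa : q (q (a (a (a t)))) = q (q (a (a (c t)))) - e • q (q (a (a (b t)))) - e • q (q (a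
    (b (a t)))) := by
  have H := h.qqcc (a t)
  simp only [map_neg, map_zsmul, h.bb, h.ca] at H
  rcases h.sign with rfl | rfl <;> linear_combination (norm := module) H

theorem qqcba : q (q (c (b (a t)))) = (2 + 2 * e) • q (q (a (a (b t)))) + e • q (q (a (c (c t))))
    - q (q (a (a (c t)))) := by
  have H := h.qqba (a t)
  simp only [map_add, map_sub, map_zsmul, h.bc, h.ca, h.baa, h.qqcc] at H
  rcases h.sign with he | he <;> linear_combination (norm := (subst he; module)) e • H - (2 + e) •
    h.qqaaa t

theorem qaaap : q (a (a (a (p t)))) = (2 * e) • q (q (a (a (c t)))) + e • q (a (a (c (p t)))) - 2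
    • q (q (a (a (b t)))) - (1 - e) • q (q (a (c (c t)))) - (1 - e) • q (q (a (b (a t)))) := by
  have H := h.qaap (b t)
  simp only [map_add, map_sub, map_neg, map_zsmul, h.bb, h.bc, h.ca, h.pb] at H
  rcases h.sign with he | he <;> linear_combination (norm := (subst he; module)) e • H - e •
    h.qaabp t + e • h.qqaaa t

theorem qqacc : q (q (a (c (c t)))) = (1 - e) • q (q (a (b (a t)))) - (2 * e) • q (q (a (a (c
    t)))) - (1 + 2 * e) • q (q (a (a (b t)))) := by
  have H := h.qacq (b t)
  simp only [map_add, map_sub, map_neg, map_zsmul, map_nsmul, h.bb, h.bc, h.ca, h.acqb, h.qacq,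
    h.qqcc] at H
  rcases h.sign with rfl | rfl <;> linear_combination (norm := module) -H - h.qqcba t

theorem nf_qcqac : q (c (q (a (c t)))) = e • q (q (a (a (c t)))) + q (q (a (c (c t)))) + q (a (c
    (b (p t)))) - q (q (a (a (a t)))) - e • q (q (a (b (a t)))) - q (a (a (c (p t)))) := by
  simp only [map_sub, map_neg, map_zsmul, h.bb, h.bc, h.ca, h.pc, h.qcqa, h.qqcc]
  rcases h.sign with rfl | rfl <;> module

theorem qabpa : q (a (b (p (a t)))) = (3 - e) • q (q (a (b (a t)))) + (3 - 2 * e) • q (q (a (a (b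
    t)))) + (4 - e) • q (q (a (a (c t)))) - q (a (a (c (p t)))) := by
  have H := h.aq (c (b (p t)))
  simp only [map_add, map_sub, map_neg, map_zsmul, h.aq, h.bc, h.ca, h.acpa, h.qcbp, h.qcqa (a t),
    h.nf_qcqac t] at H
  rcases h.sign with he | he <;> linear_combination (norm := (subst he; module)) H - e • h.qccbp t
    + h.qaccp t - (3 * e) • h.qqaaa t - e • h.qqcba t - e • h.qqacc t

theorem nf_aqqab : a (q (q (a (b t)))) = (1 + e) • q (q (a (b (a t)))) + e • q (q (c (b (a t)))) +
    (2 * e) • q (q (a (a (a t)))) + (1 + e) • q (q (a (a (b t)))) + e • q (a (a (a (p t)))) + q (a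
    (a (c (p t)))) + q (a (b (p (a t)))) - q (a (c (c (p t)))) - e • q (q (a (a (c t)))) := by
  simp only [map_add, map_sub, map_neg, map_zsmul, h.aq, h.bb, h.ca, h.acpa, h.cqab, h.qacq,
    h.qcqa]
  rcases h.sign with rfl | rfl <;> module

theorem nf_cqcb : c (q (c (b t))) = q (a (a (c t))) + (1 + e) • a (c (q (a t))) + e • c (q (a (a
    t))) - (3 * e) • q (c (c (c t))) - (2 + 4 * e) • q (a (c (c t))) - 2 • q (a (a (b t))) - (1 -
    2 * e) • q (a (a (a t))) - e • q (c (b (a t))) - q (c (c (b t))) - q (a (c (b t))) - (3 + e) •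
    q (a (b (a t))) := by
  simp only [map_sub, map_neg, map_zsmul, h.bb, h.bc, h.ca, h.cqc, h.acqb, h.cqab]
  rcases h.sign with rfl | rfl <;> module

theorem nf_aqqcb : a (q (q (c (b t)))) = (1 - e) • q (q (a (c (c t)))) + q (a (c (c (p t)))) - 2 •
    q (q (a (a (c t)))) - (2 * e) • q (q (c (b (a t)))) - 2 • q (q (a (b (a t)))) - (2 * e) • q (q
    (a (a (a t)))) - e • q (a (a (a (p t)))) - q (a (a (c (p t)))) - q (a (b (p (a t)))) - q (q (a
    (a (b t)))) := by
  simp only [map_add, map_sub, map_neg, map_zsmul, map_nsmul, h.aq, h.bb, h.bc, h.ca, h.acpa,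
    h.qacq, h.qcqa, h.qqcc, h.nf_cqcb t]
  rcases h.sign with rfl | rfl <;> module

theorem qabap : q (a (b (a (p t)))) = (1 + 2 * e) • q (q (a (a (b t)))) - q (a (a (c (p t)))) - (1
    - e) • q (q (a (a (c t)))) - (3 - e) • q (q (a (b (a t)))) := by
  have H := h.aq (a (a (p t)))
  simp only [map_add, map_sub, map_neg, map_zsmul, h.aq (a (a t)), h.aq (q (a (a t))), h.ca,
    h.acpa, h.qaap, h.qcqa, h.nf_aqqab t, h.nf_aqqcb t] at H
  rcases h.sign with he | he <;> linear_combination (norm := (subst he; module)) H + e • h.qaccp t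
    - (2 - e) • h.qqaaa t - (1 - e) • h.qqcba t - e • h.qaaap t - (2 - e) • h.qqacc t - e •
    h.qabpa t

theorem qccba : q (c (c (b (a t)))) = (3 + e) • q (a (a (c (b t)))) + (11 + 17 * e) • q (a (a (a
    (c t)))) + (4 + 3 * e) • q (a (a (a (a t)))) + (1 - 3 * e) • q (a (a (c (c t)))) - (2 + 7 * e)
    • q (a (a (b (a t)))) - (1 - 2 * e) • q (a (a (a (b t)))) - 2 • q (a (c (b (a t)))) := by
  have H := h.acqb (a t)
  simp only [map_add, map_sub, map_neg, map_zsmul, map_nsmul, h.aq, h.bb, h.bc, h.ca, h.baa,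
    h.bab, h.bac, h.accc, h.cccc, h.cqba, h.nf_aacqa t] at H
  rcases h.sign with he | he <;> linear_combination (norm := (subst he; module)) -H + e • h.acqaa
    t - (1 - e) • h.qaccb t

theorem nf_cqbpa : c (q (b (p (a t)))) = (3 + 3 * e) • q (a (b (p (a t)))) + (3 + 5 * e) • q (q (a
    (a (b t)))) + (10 + 10 * e) • q (a (a (a (p t)))) + (4 + 3 * e) • q (q (a (a (a t)))) + (7 + 8
    * e) • q (c (c (c (p t)))) - (4 + e) • q (a (c (c (p t)))) - (5 + 3 * e) • q (q (a (b (a t))))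
    - (2 + 4 * e) • q (q (c (b (a t)))) - (3 + 2 * e) • q (c (b (a (p t)))) - (6 + 4 * e) • q (a
    (a (b (p t)))) - (3 + 2 * e) • q (c (c (b (p t)))) := by
  simp only [map_add, map_sub, map_zsmul, map_nsmul, h.ca, h.acpa, h.bapa, h.cqbp, h.qaap]
  rcases h.sign with rfl | rfl <;> module

theorem nf_acqpa : a (c (q (p (a t)))) = (3 * e) • q (q (a (b (a t)))) + 3 • q (q (c (b (a t)))) +
    (2 * e) • q (c (b (a (p t)))) + (4 * e) • q (a (a (b (p t)))) + (2 * e) • q (c (c (b (p t))))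
    - 2 • q (q (a (a (b t)))) - (1 + 3 * e) • q (q (a (a (a t)))) - (1 + e) • q (a (b (p (a t))))
    - (4 + 2 * e) • q (c (c (c (p t)))) - (1 - 2 * e) • q (a (a (c (p t)))) - (1 - 2 * e) • q (a
    (c (c (p t)))) - (2 + 5 * e) • q (a (a (a (p t)))) := by
  simp only [map_add, map_sub, map_zsmul, map_nsmul, h.ca, h.acpa, h.acqp, h.bapa, h.qaap]
  rcases h.sign with rfl | rfl <;> module

theorem nf_ccqpa : c (c (q (p (a t)))) = (8 + 2 * e) • q (q (a (b (a t)))) + (1 + 7 * e) • q (q (c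
    (b (a t)))) + (4 + 2 * e) • q (c (b (a (p t)))) + q (a (a (c (p t)))) + 5 • q (a (c (c (p
    t)))) + (8 + 4 * e) • q (a (a (b (p t)))) + (4 + 2 * e) • q (c (c (b (p t)))) - (2 + 7 * e) •
    q (q (a (a (b t)))) - (6 + 2 * e) • q (q (a (a (a t)))) - (5 + 4 * e) • q (a (b (p (a t)))) -
    (8 + 10 * e) • q (c (c (c (p t)))) - (12 + 11 * e) • q (a (a (a (p t)))) := by
  simp only [map_add, map_sub, map_zsmul, map_nsmul, h.ca, h.ccq, h.acpa, h.bapa, h.cqap, h.qaap,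
    h.qccp, h.nf_acqpa t, h.nf_cqbpa t]
  rcases h.sign with rfl | rfl <;> module

theorem nf_bcqpa : b (c (q (p (a t)))) = (4 + e) • q (q (a (b (a t)))) + (1 + 5 * e) • q (q (c (b
    (a t)))) + (4 + 2 * e) • q (c (b (a (p t)))) + (6 + e) • q (a (c (c (p t)))) + (8 + 4 * e) • q
    (a (a (b (p t)))) + (4 + 2 * e) • q (c (c (b (p t)))) + (2 + 4 * e) • q (q (a (a (c t)))) + (1
    - e) • q (q (a (c (c t)))) - (6 + 9 * e) • q (q (a (a (b t)))) - (8 + 4 * e) • q (q (a (a (a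
    t)))) - (7 + 5 * e) • q (a (b (p (a t)))) - (8 + 10 * e) • q (c (c (c (p t)))) - (13 + 12 * e)
    • q (a (a (a (p t)))) - e • q (a (c (b (p t)))) := by
  simp only [map_add, map_sub, map_neg, map_zsmul, h.aq (a (a t)), h.aq (a (c t)), h.aq (p (a t)),
    h.aq (a (p (a t))), h.aq (q (a (a t))), h.aq (q (a (c t))), h.bc, h.ca, h.qcp, h.acpa, h.qaap,
    h.qcqa (a t), h.qqba, h.nf_aqqab t, h.nf_aqqcb t, h.nf_ccqpa t, h.nf_qcqac t]
  rcases h.sign with rfl | rfl <;> module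

theorem nf_bqapa : b (q (a (p (a t)))) = (3 + 3 * e) • q (a (b (p (a t)))) + (3 + 2 * e) • q (q (a
    (a (b t)))) + (1 + 2 * e) • q (q (a (a (a t)))) + (5 + 4 * e) • q (c (c (c (p t)))) + (1 - e)
    • q (a (a (c (p t)))) + (5 + 7 * e) • q (a (a (a (p t)))) - (2 + e) • q (q (c (b (a t)))) - (2
    + 3 * e) • q (q (a (b (a t)))) - (1 + 2 * e) • q (c (b (a (p t)))) - (1 + 2 * e) • q (a (c (c
    (p t)))) - (2 + 4 * e) • q (a (a (b (p t)))) - (1 + 2 * e) • q (c (c (b (p t)))) := by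
  simp only [map_add, map_sub, map_zsmul, map_nsmul, h.bq, h.ca, h.bapa, h.cqap, h.qaap]
  rcases h.sign with rfl | rfl <;> module

theorem nf_cqqaa : c (q (q (a (a t)))) = q (a (c (c (p t)))) + q (q (a (c (c t)))) + (1 + e) • q
    (q (a (a (c t)))) - (1 + 2 * e) • q (q (a (a (a t)))) - e • q (q (a (b (a t)))) - e • q (q (c
    (b (a t)))) - e • q (q (a (a (b t)))) - e • q (a (a (a (p t)))) - q (a (a (c (p t)))) - q (a
    (b (p (a t)))) := by
  simp only [map_add, map_sub, map_zsmul, h.bc, h.ca, h.baa, h.cqq, h.acpa, h.qcqa, h.qqcc]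
  rcases h.sign with rfl | rfl <;> module

theorem nf_bqqaa : b (q (q (a (a t)))) = 0 := by
  simp only [map_add, map_sub, map_neg, map_zsmul, h.aq, h.bc, h.bq, h.ca, h.baa, h.acpa, h.qcqa,
    h.qqcc, h.nf_cqqaa t]
  rcases h.sign with rfl | rfl <;> module

theorem nf_pabpa : p (a (b (p (a t)))) = (3 + 4 * e) • q (a (b (p (a t)))) + (2 + e) • q (q (a (a
    (b t)))) + (8 + 7 * e) • q (c (c (c (p t)))) + (9 + 9 * e) • q (a (a (a (p t)))) + (2 + 4 * e)
    • q (q (a (a (c t)))) + (1 - e) • q (q (a (c (c t)))) - (4 + 2 * e) • q (q (c (b (a t)))) - (6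
    + 7 * e) • q (q (a (b (a t)))) - (1 - 2 * e) • q (q (a (a (a t)))) - (2 + 3 * e) • q (c (b (a
    (p t)))) - (3 * e) • q (a (c (c (p t)))) - (4 + 6 * e) • q (a (a (b (p t)))) - (2 + 3 * e) • q
    (c (c (b (p t)))) - e • q (a (c (b (p t)))) - q (a (a (c (p t)))) := by
  simp only [map_add, map_sub, map_neg, map_zsmul, h.bb, h.bq (b (p (a t))), h.pab, h.pap, h.acpa,
    h.nf_bcqpa t, h.nf_bqapa t, h.nf_bqqaa t, h.nf_cqbpa t]
  rcases h.sign with rfl | rfl <;> module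

theorem qacbp : q (a (c (b (p t)))) = 4 • q (q (a (a (b t)))) + q (a (a (c (p t)))) + (1 - e) • q
    (q (a (a (c t)))) - e • q (q (a (b (a t)))) := by
  have H := h.pap (a (b t))
  simp only [map_add, map_sub, map_neg, map_zsmul, h.bb, h.pab t, h.acpa, h.nf_cqbpa t, h.nf_pabpa
    t] at H
  rcases h.sign with he | he <;> linear_combination (norm := (subst he; module)) -H + e • h.qaccp
    t - (2 + 4 * e) • h.qqaaa t - (2 - e) • h.qqacc t - e • h.qabpa t

theorem nf_ccqa : c (c (q (a t))) = (1 - e) • q (a (b (a t))) + (1 + e) • q (a (c (c t))) + e • q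
    (c (c (c t))) - e • q (a (a (c t))) - e • q (a (a (b t))) - (1 + 3 * e) • q (a (a (a t))) - e
    • q (a (c (b t))) - e • c (q (a (a t))) := by
  simp only [map_add, map_sub, map_neg, map_zsmul, h.bb, h.ca, h.baa, h.ccq, h.cqba]
  rcases h.sign with rfl | rfl <;> module

theorem nf_bacqa : b (a (c (q (a t)))) = (5 - e) • q (a (a (a (c t)))) + (2 + 2 * e) • q (a (a (a
    (a t)))) + (2 - e) • q (a (a (a (b t)))) + (1 + e) • q (a (c (b (a t)))) - (2 - 4 * e) • q (a
    (a (c (b t)))) - (3 - 4 * e) • q (a (a (c (c t)))) - (1 - 2 * e) • q (a (a (b (a t)))) := by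
  simp only [map_add, map_sub, map_neg, map_zsmul, map_nsmul, h.aq, h.bb, h.bc, h.bq, h.ca, h.baa,
    h.bab, h.bac, h.accc, h.cccc, h.cqba, h.nf_ccqa t, h.nf_aacqa t]
  rcases h.sign with rfl | rfl <;> module

theorem nf_cqccc : c (q (c (c (c t)))) = (3 + 2 * e) • q (a (a (a (b t)))) + (2 + e) • q (a (a (c
    (c t)))) + 3 • q (a (a (b (a t)))) + (1 - 3 * e) • q (a (a (a (a t)))) + (1 + 2 * e) • q (a (c
    (b (a t)))) + a (c (q (a (c t)))) - q (a (a (c (b t)))) - (4 + 2 * e) • q (a (a (a (c t)))) -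
    e • q (a (c (c (b t)))) - c (q (a (c (c t)))) := by
  simp only [map_add, map_sub, map_neg, map_zsmul, map_nsmul, h.aq, h.bb, h.bc, h.ca, h.baa,
    h.bab, h.bac, h.cqc (c (c t)), h.accc, h.cccb, h.cccc, h.nf_cqcc t, h.nf_aacqa t]
  rcases h.sign with rfl | rfl <;> module

theorem nf_ccqaa : c (c (q (a (a t)))) = (1 - 2 * e) • q (a (a (b (a t)))) + 2 • q (a (a (a (a
    t)))) + (1 + e) • q (a (a (c (b t)))) + (2 + 5 * e) • q (a (a (a (c t)))) + q (a (c (c (b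
    t)))) + c (q (a (a (c t)))) - a (c (q (a (a t)))) - (3 + 2 * e) • q (a (a (a (b t)))) - (1 + 2
    * e) • q (a (a (c (c t)))) - (2 + e) • q (a (c (b (a t)))) - e • a (c (q (a (c t)))) - c (q (a
    (a (a t)))) := by
  simp only [map_add, map_sub, map_neg, map_zsmul, h.bb, h.ca, h.baa, h.bac, h.ccq, h.nf_cqccc t]
  rcases h.sign with rfl | rfl <;> module

theorem nf_bcqaa : b (c (q (a (a t)))) = (2 - e) • q (a (a (a (a t)))) + (2 + e) • q (a (a (c (b
    t)))) + (3 + 7 * e) • q (a (a (a (c t)))) + q (a (c (c (b t)))) + c (q (a (a (c t)))) - a (c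
    (q (a (a t)))) - (2 + e) • q (a (a (a (b t)))) - (3 * e) • q (a (a (b (a t)))) - (3 * e) • q
    (a (a (c (c t)))) - (2 + e) • q (a (c (b (a t)))) - e • a (c (q (a (c t)))) - c (q (a (a (a
    t)))) := by
  simp only [map_add, map_sub, map_neg, map_zsmul, map_nsmul, h.aq, h.bb, h.bc, h.ca, h.baa,
    h.accc, h.nf_ccqaa t]
  rcases h.sign with rfl | rfl <;> module

theorem nf_cqaba : c (q (a (b (a t)))) = (2 - e) • q (a (a (c (c t)))) + 2 • q (a (a (b (a t)))) +
    q (a (a (a (a t)))) - e • a (c (q (a (a t)))) - (5 + 2 * e) • q (a (a (a (c t)))) - (2 * e) •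
    q (a (a (c (b t)))) - q (a (a (a (b t)))) - e • c (q (a (a (a t)))) := by
  simp only [map_add, map_sub, map_zsmul, map_nsmul, h.bc, h.ca, h.baa, h.bac, h.accc, h.cccc,
    h.cqab]
  rcases h.sign with rfl | rfl <;> module

theorem nf_bqaba : b (q (a (b (a t)))) = (2 - e) • q (a (a (c (c t)))) + 3 • q (a (a (b (a t)))) -
    e • a (c (q (a (a t)))) - (5 + 2 * e) • q (a (a (a (c t)))) - (2 * e) • q (a (a (c (b t)))) -
    2 • q (a (a (a (b t)))) - e • c (q (a (a (a t)))) := by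
  simp only [map_sub, map_neg, map_zsmul, h.bq, h.ca, h.bab, h.nf_cqaba t]
  rcases h.sign with rfl | rfl <;> module

theorem nf_bqccc : b (q (c (c (c t)))) = (3 + 3 * e) • q (a (a (a (b t)))) + (2 + e) • q (a (a (c
    (c t)))) + 3 • q (a (a (b (a t)))) + (1 - 3 * e) • q (a (a (a (a t)))) + (1 + 2 * e) • q (a (c
    (b (a t)))) + a (c (q (a (c t)))) - (4 + 2 * e) • q (a (a (a (c t)))) - e • q (a (c (c (b
    t)))) - c (q (a (c (c t)))) := by
  simp only [map_add, map_sub, map_zsmul, map_nsmul, h.bc, h.bq, h.accc, h.cccc, h.nf_cqccc t]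
  rcases h.sign with rfl | rfl <;> module

theorem nf_bcqa : b (c (q (a t))) = (1 + e) • q (a (c (c t))) + e • q (c (c (c t))) - (1 + e) • q
    (a (a (b t))) - (1 + 4 * e) • q (a (a (a t))) - e • q (a (b (a t))) - e • q (a (c (b t))) - e
    • c (q (a (a t))) := by
  simp only [map_sub, map_neg, map_zsmul, h.aq, h.bb, h.bc, h.ca, h.nf_ccqa t]
  rcases h.sign with rfl | rfl <;> module

theorem nf_cacqa : c (a (c (q (a t)))) = (3 * e) • q (a (a (a (a t)))) + (4 * e) • q (a (a (b (a
    t)))) + q (a (c (c (b t)))) - (4 + 7 * e) • q (a (a (a (c t)))) - (4 * e) • q (a (a (a (b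
    t)))) - (4 - 3 * e) • q (a (a (c (c t)))) - 3 • q (a (a (c (b t)))) - a (c (q (a (a t)))) :=
    by
  simp only [map_add, map_sub, map_neg, map_zsmul, map_nsmul, h.aq, h.bb, h.bc (b t), h.bc (c t),
    h.ca, h.baa, h.bab, h.accc, h.cccc, h.nf_bcqa t]
  rcases h.sign with rfl | rfl <;> module

/-- This comes from the overlap bcqba of `bc` with `cqba`. Its reductions pass through many
intermediate words, whose normal forms are the `nf` lemmas before it. -/
theorem qaacc : q (a (a (c (c t)))) = (3 + 6 * e) • q (a (a (a (c t)))) + (3 - e) • q (a (a (c (b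
    t)))) + (4 * e) • q (a (a (a (b t)))) + (1 + 5 * e) • q (a (a (a (a t)))) + (2 + e) • q (a (c
    (b (a t)))) - 2 • q (a (a (b (a t)))) := by
  have H := h.bc (q (b (a t)))
  simp only [map_add, map_sub, map_neg, map_zsmul, map_nsmul, h.aq, h.bb, h.bc t, h.bq (a (a (a
    t))), h.bq (a (a (b t))), h.bq (a (a (c t))), h.bq (a (c (b t))), h.bq (a (c (c t))), h.ca t,
    h.ca (a t), h.ca (b t), h.ca (c t), h.ca (a (c t)), h.ca (b (a t)), h.baa (a t), h.baa (b t),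
    h.bac t, h.bac (b t), h.bac (c t), h.accc, h.cccb, h.cqba, h.nf_baac t, h.nf_bacqa t,
    h.nf_bcqaa t, h.nf_bqaba t, h.nf_bqccc t, h.nf_cacqa t, h.nf_ccqaa t, h.nf_cqaba t, h.nf_cqccc
    t] at H
  rcases h.sign with he | he <;> linear_combination (norm := (subst he; module)) -H - h.acqaa t -
    (1 - e) • h.qaccb t + e • h.qccba t

theorem nf_bqqb : b (q (q (b t))) = 0 := by
  simp only [map_add, map_sub, map_neg, map_zsmul, h.aq, h.bb, h.bq, h.cqq, h.qcqb]
  rcases h.sign with rfl | rfl <;> module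

theorem nf_cqqab : c (q (q (a (b t)))) = e • q (q (a (a (b t)))) + (1 + e) • q (q (a (b (a t)))) +
    q (q (c (b (a t)))) + 3 • q (q (a (a (a t)))) + q (a (a (a (p t)))) + e • q (a (a (c (p t))))
    + e • q (a (b (p (a t)))) - e • q (a (c (c (p t)))) - (1 - e) • q (q (a (a (c t)))) := by
  simp only [map_add, map_sub, map_neg, map_zsmul, h.bb, h.ca, h.bab, h.cqq, h.acpa, h.cqab,
    h.qacq, h.qcqa]
  rcases h.sign with rfl | rfl <;> module

theorem nf_bqqab : b (q (q (a (b t)))) = 0 := by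
  simp only [map_add, map_sub, map_neg, map_zsmul, h.aq, h.bb, h.bq, h.ca, h.bab, h.acpa, h.cqab,
    h.qacq, h.qcqa, h.nf_cqqab t]
  rcases h.sign with rfl | rfl <;> module

theorem nf_bqcb : b (q (c (b t))) = q (a (a (c t))) + (1 + e) • a (c (q (a t))) + e • c (q (a (a
    t))) - (3 * e) • q (c (c (c t))) - (2 + 4 * e) • q (a (c (c t))) - (2 + e) • q (a (a (b t))) -
    (1 - 2 * e) • q (a (a (a t))) - e • q (c (b (a t))) - (3 + e) • q (a (b (a t))) := by
  simp only [map_sub, map_zsmul, h.bc, h.bq, h.nf_cqcb t]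
  rcases h.sign with rfl | rfl <;> module

theorem nf_cqqcb : c (q (q (c (b t)))) = e • q (a (c (c (p t)))) + q (q (a (a (b t)))) - (1 - e) •
    q (q (a (c (c t)))) - (3 * e) • q (q (a (a (c t)))) - 2 • q (q (c (b (a t)))) - (2 * e) • q (q
    (a (b (a t)))) - 2 • q (q (a (a (a t)))) - q (a (a (a (p t)))) - e • q (a (a (c (p t)))) - e •
    q (a (b (p (a t)))) := by
  simp only [map_add, map_sub, map_neg, map_zsmul, map_nsmul, h.bb, h.bc, h.ca, h.cqq, h.acpa,
    h.qacq, h.qcqa, h.qqcc, h.nf_cqcb t]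
  rcases h.sign with rfl | rfl <;> module

theorem nf_bqqcb : b (q (q (c (b t)))) = 0 := by
  simp only [map_add, map_sub, map_neg, map_zsmul, h.aq, h.bb, h.bc, h.bq (q (c (b t))), h.ca,
    h.acpa, h.qacq, h.qcqa, h.qqcc, h.nf_bqcb t, h.nf_cqqcb t]
  rcases h.sign with rfl | rfl <;> module

theorem nf_cqabp : c (q (a (b (p t)))) = (1 + 2 * e) • q (a (a (b (p t)))) + (2 - 6 * e) • q (q (a
    (b (a t)))) + (2 + 3 * e) • q (a (c (b (p t)))) + (10 - e) • q (q (a (a (c t)))) + (1 - 2 * e)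
    • q (a (b (p (a t)))) + (2 - 5 * e) • q (q (a (a (b t)))) + (1 + 2 * e) • q (c (b (a (p t))))
    + (1 + 3 * e) • q (a (b (a (p t)))) - (3 + 6 * e) • q (a (a (c (p t)))) - (5 - 3 * e) • q (q
    (a (a (a t)))) - (2 - 3 * e) • q (q (a (c (c t)))) - (2 - 4 * e) • q (q (c (b (a t)))) - (1 -
    2 * e) • q (a (c (c (p t)))) - (1 - e) • q (a (a (a (p t)))) := by
  simp only [map_add, map_sub, map_neg, map_zsmul, map_nsmul, h.aq (a (a t)), h.aq (a (c t)), h.aq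
    (a (b (p t))), h.aq (b (a (p t))), h.aq (q (a (a t))), h.aq (q (a (c t))), h.bb, h.bc, h.ca,
    h.acpa, h.cqab, h.cqap, h.qaap, h.qcqa (a t), h.nf_aqqab t, h.nf_aqqcb t, h.nf_cqqaa t,
    h.nf_cqqab t, h.nf_cqqcb t, h.nf_qcqac t]
  rcases h.sign with rfl | rfl <;> module

theorem nf_cqqa : c (q (q (a t))) = 2 • q (q (a (b t))) - 2 • q (q (a (c t))) - q (a (c (p t))) -
    q (a (b (p t))) := by
  simp only [map_zsmul, h.ca, h.cqq, h.qcqa, h.qqba]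
  rcases h.sign with rfl | rfl <;> module

theorem nf_bqqa : b (q (q (a t))) = 0 := by
  simp only [map_add, map_sub, map_neg, map_zsmul, h.aq, h.bq, h.ca, h.qcqa, h.qqba, h.nf_cqqa t]
  rcases h.sign with rfl | rfl <;> module

theorem nf_bqqac : b (q (q (a (c t)))) = 0 := by
  simp only [map_add, map_sub, map_neg, map_zsmul, h.aq, h.bc, h.bq, h.ca, h.bac, h.cqq,
    h.nf_qcqac t]
  rcases h.sign with rfl | rfl <;> module

theorem nf_pacqa : p (a (c (q (a t)))) = (4 - 4 * e) • q (q (a (b (a t)))) + (6 - e) • q (q (a (a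
    (b t)))) + (2 - e) • q (a (b (p (a t)))) + (5 - 6 * e) • q (q (a (a (c t)))) + (4 + 4 * e) • q
    (a (c (b (p t)))) + c (q (a (c (p t)))) + (2 + 2 * e) • q (a (a (b (p t)))) + (1 + 2 * e) • q
    (c (b (a (p t)))) + (1 + 3 * e) • q (a (b (a (p t)))) - (2 - 6 * e) • q (q (a (a (a t)))) - (2
    - e) • q (a (c (c (p t)))) - (1 - 2 * e) • q (a (a (a (p t)))) - (2 + 7 * e) • q (a (a (c (p
    t)))) - (2 - 3 * e) • q (q (a (c (c t)))) - (2 - 4 * e) • q (q (c (b (a t)))) := by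
  simp only [map_add, map_sub, map_neg, map_zsmul, map_nsmul, map_zero, h.aq (a t), h.aq (a (a
    t)), h.aq (a (c t)), h.aq (q (a t)), h.aq (a (b (p t))), h.aq (a (c (p t))), h.aq (q (a (a
    t))), h.aq (q (a (c t))), h.bb, h.bc, h.bq (a (b (p t))), h.bq (a (c (p t))), h.ca, h.pq,
    h.bab, h.bac, h.pac, h.acpa, h.qcqa t, h.qcqa (a t), h.nf_bqqa t, h.nf_cqqa t, h.nf_aqqab t,
    h.nf_aqqcb t, h.nf_bqqaa t, h.nf_bqqab t, h.nf_bqqac t, h.nf_bqqcb t, h.nf_cqabp t, h.nf_qcqac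
    t]
  rcases h.sign with rfl | rfl <;> module

theorem qqaac : q (q (a (a (c t)))) = (3 * e) • q (q (a (a (b t)))) - (1 - e) • q (q (a (b (a
    t)))) := by
  have H := h.pac (q (b t))
  simp only [map_add, map_sub, map_neg, map_zsmul, map_nsmul, map_zero, h.aq (b t), h.aq (a (a
    t)), h.aq (a (c t)), h.aq (q (b t)), h.aq (a (b (p t))), h.aq (a (c (p t))), h.aq (q (a (a
    t))), h.aq (q (a (c t))), h.bb, h.bc, h.bq (a (b (p t))), h.bq (a (c (p t))), h.ca, h.pq,
    h.bab, h.bac, h.cqq, h.acpa, h.acqb, h.qcqa (a t), h.qcqb, h.qqcc, h.nf_bqqb t, h.nf_aqqab t,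
    h.nf_aqqcb t, h.nf_bqqaa t, h.nf_bqqab t, h.nf_bqqcb t, h.nf_cqabp t, h.nf_pacqa t, h.nf_qcqac
    t] at H
  rcases h.sign with he | he <;> linear_combination (norm := (subst he; module)) -H - (1 - e) •
    h.qqaaa t + (2 * e) • h.qqcba t + e • h.qqacc t

theorem nf_cqqc : c (q (q (c t))) = (2 * e) • q (q (a (b t))) + e • q (q (c (b t))) + (1 + 2 * e)
    • q (q (a (a t))) + q (a (c (p t))) + q (a (b (p t))) + q (q (a (c t))) := by
  simp only [map_add, map_sub, map_zsmul, h.bc, h.cqc, h.cqq, h.qacq, h.qcqa, h.qqcc]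
  rcases h.sign with rfl | rfl <;> module

/-- The last rule in the degree with two letters from p, q: afterwards only the words qqaab and
qqaba remain there, to be killed by `qqaab` and `qqaba`. -/
theorem qaacp : q (a (a (c (p t)))) = (10 - 14 * e) • q (q (a (b (a t)))) + (11 - 31 * e) • q (q
    (a (a (b t)))) := by
  have H := h.ccq (c (p t))
  simp only [map_add, map_sub, map_neg, map_zsmul, map_nsmul, h.aq (a (a t)), h.aq (a (c t)), h.aq
    (a (b (p t))), h.aq (a (c (p t))), h.aq (q (a (a t))), h.aq (q (a (c t))), h.bb, h.bc, h.ca,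
    h.bac, h.cqq (b t), h.cqq (a (c t)), h.qcp, h.acpa, h.qaap, h.qccp, h.qcqa (a t), h.qcqb,
    h.nf_cqqa t, h.nf_cqqc t, h.nf_aqqab t, h.nf_aqqcb t, h.nf_cqabp t, h.nf_cqqaa t, h.nf_cqqab
    t, h.nf_cqqcb t, h.nf_qcqac t] at H
  rcases h.sign with he | he <;> linear_combination (norm := (subst he; module)) -(e • H) +
    h.qaabp t - h.qcccp t - (1 + e) • h.qaccp t + h.qqacb t - e • h.qcbap t + (5 + 2 * e) •
    h.qqaaa t + (3 - e) • h.qqcba t - (1 + e) • h.qaaap t + (2 + 3 * e) • h.qqacc t + (2 * e) •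
    h.qabpa t + e • h.qabap t + (2 + e) • h.qacbp t - (13 - 3 * e) • h.qqaac t

theorem nf_paaab : p (a (a (a (b t)))) = a (a (a (a (p t)))) + e • a (a (a (c (p t)))) - (2 * e) •
    a (a (c (c (p t)))) - e • a (a (c (b (p t)))) := by
  simp only [map_add, map_sub, map_neg, map_zsmul, h.bb, h.bc, h.ca, h.baa, h.bac, h.paa, h.pab,
    h.accc, h.acpa]
  rcases h.sign with rfl | rfl <;> module

theorem nf_paaac : p (a (a (a (c t)))) = (1 - 3 * e) • a (a (c (c (p t)))) + (1 - 4 * e) • a (a (c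
    (b (p t)))) + e • a (c (b (a (p t)))) + 2 • a (a (b (a (p t)))) - (3 + e) • a (a (a (c (p
    t)))) - (5 + e) • a (a (a (b (p t)))) := by
  simp only [map_add, map_sub, map_neg, map_zsmul, h.bb, h.bc, h.ca, h.baa, h.bab, h.bac, h.paa,
    h.pac, h.accc, h.cccb, h.cccc]
  rcases h.sign with rfl | rfl <;> module

theorem nf_paaba : p (a (a (b (a t)))) = (10 + 4 * e) • a (a (c (c (p t)))) + (4 + 7 * e) • a (a
    (a (c (p t)))) + (6 + e) • a (a (c (b (p t)))) + (5 + 8 * e) • a (a (a (b (p t)))) + (2 + e) •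
    a (a (a (p (a t)))) + (2 + e) • a (c (c (b (p t)))) + a (c (c (p (a t)))) + e • a (c (b (a (p
    t)))) - (1 + 5 * e) • a (a (b (a (p t)))) - e • c (c (c (p (a t)))) - (1 + e) • a (a (b (p (a
    t)))) - (4 + 2 * e) • a (a (a (a (p t)))) - c (c (b (a (p t)))) := by
  simp only [map_add, map_sub, map_neg, map_zsmul, map_nsmul, h.bb, h.bc, h.ca, h.pb, h.baa,
    h.bab, h.bac, h.paa, h.accc, h.acpa, h.bapa, h.cccb, h.cccc]
  rcases h.sign with rfl | rfl <;> module

theorem cccpa : c (c (c (p (a t)))) = -((105 + 108 * e) • a (a (c (c (p t))))) - (111 + 100 * e) •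
    a (a (a (c (p t)))) - (51 + 60 * e) • a (a (c (b (p t)))) - (42 + 31 * e) • a (c (b (a (p
    t)))) := by
  have H := h.pc (c (c (c t)))
  simp only [map_add, map_sub, map_neg, map_zsmul, map_nsmul, h.bb, h.bc, h.ca, h.pc, h.bac, h.paa
    (c (c t)), h.cccc, h.nf_paaab t, h.nf_paaac t, h.nf_paaba t, h.nf_paacb t] at H
  rcases h.sign with he | he <;> linear_combination (norm := (subst he; module)) e • H + e •
    h.accpa t + (4 + 3 * e) • h.accbp t - (6 + 6 * e) • h.aabap t - (1 + e) • h.aabpa t + (4 + 7 *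
    e) • h.aaabp t + (4 - 6 * e) • h.aaaap t - e • h.ccbap t + (2 + 2 * e) • h.aaapa t

/-! ### Residual system for words without p and q -/

theorem res_accc_cccb : (30 - 27 * e) • a (a (a (a (b t)))) - (41 - 49 * e) • a (a (a (a (c t))))
    - (16 - 17 * e) • a (a (a (a (a t)))) - (34 - 26 * e) • a (a (a (c (c t)))) = 0 := by
  have H := h.accc (b t)
  simp only [map_add, map_sub, map_neg, map_zsmul, h.bb, h.bc, h.ca, h.bab, h.cccb] at H
  rcases h.sign with he | he <;> linear_combination (norm := (subst he; module)) -H - (1 - e) •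
    h.aaccb t + (2 - e) • h.aacba t + (2 - 2 * e) • h.aaaba t + (8 - 5 * e) • h.aaacb t

theorem nf_baaac : b (a (a (a (c t)))) = 2 • a (a (a (a (c t)))) + e • a (a (a (c (b t)))) + a (a
    (a (a (b t)))) + a (a (a (a (a t)))) - e • a (a (a (c (c t)))) := by
  simp only [map_add, map_sub, map_neg, map_zsmul, map_nsmul, h.bb, h.bc, h.ca, h.baa t, h.baa (b
    t), h.baa (a (c t)), h.bab, h.bac, h.accc, h.cccb, h.nf_baac t]
  rcases h.sign with rfl | rfl <;> module

theorem res_bab_bab : (2 + 2 * e) • a (a (a (c (c t)))) - (1 + e) • a (a (a (a (c t)))) - (2 - e)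
    • a (a (a (a (b t)))) = 0 := by
  have H := h.bab (a (b t))
  simp only [map_add, map_sub, map_neg, map_zsmul, h.bb, h.ca, h.baa (b t), h.baa (a (a t)),
    h.bab, h.cccb, h.nf_baaac t] at H
  rcases h.sign with he | he <;> linear_combination (norm := (subst he; module)) -H + h.aacba t +
    h.aaaba t - (1 + e) • h.aaacb t

theorem res_ca_accc : (8 + 2 * e) • a (a (a (c (c t)))) + (1 - 2 * e) • a (a (a (a (a t)))) - (4 -
    2 * e) • a (a (a (a (b t)))) - (2 + 11 * e) • a (a (a (a (c t)))) = 0 := by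
  have H := h.ca (c (c (c t)))
  simp only [map_add, map_sub, map_neg, map_zsmul, map_nsmul, h.bb, h.bc, h.ca, h.baa (b t),
    h.bab, h.bac, h.accc, h.cccb, h.cccc, h.nf_baac t] at H
  rcases h.sign with he | he <;> linear_combination (norm := (subst he; module)) -H - h.aacba t -
    (1 - 2 * e) • h.aaaba t - (3 + e) • h.aaacb t

theorem res_cccc_cccc : (14 - 7 * e) • a (a (a (a (b t)))) - (5 - 25 * e) • a (a (a (a (c t)))) -
    (6 - 6 * e) • a (a (a (a (a t)))) - (18 - 3 * e) • a (a (a (c (c t)))) = 0 := by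
  have H := h.cccc (c t)
  simp only [map_add, map_sub, map_neg, map_zsmul, map_nsmul, h.bb, h.bc, h.ca, h.baa (b t),
    h.bab, h.bac, h.accc, h.cccb, h.cccc, h.nf_baac t] at H
  rcases h.sign with he | he <;> linear_combination (norm := (subst he; module)) -H + (1 + e) •
    h.aacba t - (2 * e) • h.aaaba t + (6 + e) • h.aaacb t

/-- The four residual relations form a square system in aaaaa, aaaab, aaaac, aaacc, with determinant
127 for e = 1 and 81 for e = -1, up to sign. This is the origin of the first factors in `regular`.
The multipliers here and in the next three lemmas are the rows of the inverse matrix, scaled by the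
full product in `regular`. -/
theorem aaaaa : a (a (a (a (a t)))) = 0 := by
  rcases h.regular with ⟨rfl, hN⟩ | ⟨rfl, hN⟩ <;> refine hN _ ?_
  · linear_combination (norm := module) (5520567151155 : ℤ) • h.res_accc_cccb t + (4407894702085 :
      ℤ) • h.res_bab_bab t + (85590188390 : ℤ) • h.res_ca_accc t - (1711803767800 : ℤ) •
      h.res_cccc_cccc t
  · linear_combination (norm := module) -((19975923 : ℤ) • h.res_accc_cccb t) + (19975923 : ℤ) •
      h.res_bab_bab t - (199759230 : ℤ) • h.res_ca_accc t

theorem aaaab : a (a (a (a (b t)))) = 0 := by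
  rcases h.regular with ⟨rfl, hN⟩ | ⟨rfl, hN⟩ <;> refine hN _ ?_
  · linear_combination (norm := module) (2139754709750 : ℤ) • h.res_accc_cccb t + (1497828296825 :
      ℤ) • h.res_bab_bab t + (2139754709750 : ℤ) • h.res_ca_accc t + (684721507120 : ℤ) •
      h.res_cccc_cccc t
  · linear_combination (norm := module) -((19975923 : ℤ) • h.res_bab_bab t)

theorem aaaac : a (a (a (a (c t)))) = 0 := by
  rcases h.regular with ⟨rfl, hN⟩ | ⟨rfl, hN⟩ <;> refine hN _ ?_
  · linear_combination (norm := module) -((556336224535 : ℤ) • h.res_accc_cccb t) + (1241057731655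
      : ℤ) • h.res_bab_bab t - (556336224535 : ℤ) • h.res_ca_accc t + (256770565170 : ℤ) •
      h.res_cccc_cccc t
  · linear_combination (norm := module) -((19975923 : ℤ) • h.res_accc_cccb t) + (19975923 : ℤ) •
      h.res_bab_bab t - (59927769 : ℤ) • h.res_ca_accc t + (39951846 : ℤ) • h.res_cccc_cccc t

theorem aaacc : a (a (a (c (c t)))) = 0 := by
  rcases h.regular with ⟨rfl, hN⟩ | ⟨rfl, hN⟩ <;> refine hN _ ?_
  · linear_combination (norm := module) (256770565170 : ℤ) • h.res_accc_cccb t + (2353730180725 :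
      ℤ) • h.res_bab_bab t + (256770565170 : ℤ) • h.res_ca_accc t + (299565659365 : ℤ) •
      h.res_cccc_cccc t
  · linear_combination (norm := module) (39951846 : ℤ) • h.res_accc_cccb t - (59927769 : ℤ) •
      h.res_bab_bab t + (199759230 : ℤ) • h.res_ca_accc t - (59927769 : ℤ) • h.res_cccc_cccc t

/-! ### Residual system for words with one p and no q -/

theorem res_bb_bapa : -((259 + 284 * e) • a (a (c (c (p t))))) - (261 + 240 * e) • a (a (a (c (p
    t)))) - (98 + 90 * e) • a (c (b (a (p t)))) - (131 + 147 * e) • a (a (c (b (p t)))) = 0 := by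
  have H := h.bb (a (p (a t)))
  simp only [map_add, map_sub, map_neg, map_zsmul, map_nsmul, h.bb, h.bc, h.ca, h.baa (a (p t)),
    h.baa (b (p t)), h.baa (p (a t)), h.bab, h.bac, h.accc, h.acpa, h.bapa, h.cccb, h.cccc,
    h.nf_baacp t] at H
  rcases h.sign with he | he <;> linear_combination (norm := (subst he; module)) -H - (1 + e) •
    h.accpa t + h.accbp t - (1 + e) • h.aabap t + e • h.aabpa t + (4 + 4 * e) • h.aaabp t + (2 -
    e) • h.aaaap t - h.ccbap t - (1 + 2 * e) • h.aaapa t - (1 + e) • h.cccpa t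

theorem nf_paaaa : p (a (a (a (a t)))) = a (c (b (a (p t)))) + e • a (a (b (a (p t)))) + (1 - e) •
    a (a (a (b (p t)))) - (1 + e) • a (c (c (b (p t)))) - (1 - 2 * e) • a (a (c (b (p t)))) - (1 +
    2 * e) • a (a (a (c (p t)))) - (1 - e) • a (a (c (c (p t)))) := by
  simp only [map_add, map_sub, map_neg, map_zsmul, h.bc, h.ca, h.baa, h.bab, h.bac, h.paa, h.accc,
    h.cccb]
  rcases h.sign with rfl | rfl <;> module

theorem res_pab_bab : (18 + 2 * e) • a (a (a (c (p t)))) + (4 - 6 * e) • a (c (b (a (p t)))) - (7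
    - 8 * e) • a (a (c (b (p t)))) - (9 - 12 * e) • a (a (c (c (p t)))) = 0 := by
  have H := h.pab (a (b t))
  simp only [map_add, map_sub, map_neg, map_zsmul, h.bb, h.bc, h.ca, h.pb, h.baa (a (p t)), h.bab,
    h.bac, h.paa (b t), h.accc, h.cccc, h.nf_baacp t, h.nf_paaaa t, h.nf_paaac t] at H
  rcases h.sign with he | he <;> linear_combination (norm := (subst he; module)) -H + (1 + e) •
    h.accbp t - (3 * e) • h.aabap t + (1 + 6 * e) • h.aaabp t + (6 - 4 * e) • h.aaaap t - e •
    h.ccbap t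

theorem res_cbpa_paa : -((231 + 278 * e) • a (a (c (c (p t))))) - (249 + 213 * e) • a (a (a (c (p
    t)))) - (115 + 137 * e) • a (a (c (b (p t)))) - (94 + 83 * e) • a (c (b (a (p t)))) = 0 := by
  have H := h.cbpa (a t)
  simp only [map_add, map_sub, map_neg, map_zsmul, h.bb, h.bc, h.ca, h.baa, h.bab, h.bac, h.paa,
    h.accc, h.acpa, h.cbpa, h.cccb, h.cccc] at H
  rcases h.sign with he | he <;> linear_combination (norm := (subst he; module)) -H - h.accpa t -
    e • h.accbp t + (3 - e) • h.aabap t + (2 * e) • h.aabpa t + (2 + 9 * e) • h.aaabp t + (7 - 8 *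
    e) • h.aaaap t - (3 * e) • h.aaapa t - (1 + e) • h.cccpa t

theorem res_cbpa_pac : -((9 + e) • a (c (b (a (p t))))) - (5 + 18 * e) • a (a (c (b (p t)))) - (35
    + 15 * e) • a (a (a (c (p t)))) - (7 + 31 * e) • a (a (c (c (p t)))) = 0 := by
  have H := h.cbpa (c t)
  simp only [map_add, map_sub, map_neg, map_zsmul, h.bb, h.bc, h.ca, h.pc, h.baa, h.bab, h.bac,
    h.pac, h.accc, h.cccb, h.cccc] at H
  rcases h.sign with he | he <;> linear_combination (norm := (subst he; module)) -H + e • h.accbp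
    t + (2 * e) • h.aabap t - (1 + 7 * e) • h.aaabp t - (6 - 7 * e) • h.aaaap t

/-- Again a square system, in aaacp, aacbp, aaccp, acbap, with determinant 64673 for e = 1 and 1133
for e = -1, up to sign: the second factors in `regular`. -/
theorem aaacp : a (a (a (c (p t)))) = 0 := by
  rcases h.regular with ⟨rfl, hN⟩ | ⟨rfl, hN⟩ <;> refine hN _ ?_
  · linear_combination (norm := module) -((611711182595 : ℤ) • h.res_bb_bapa t) + (1112912651615 :
      ℤ) • h.res_pab_bab t + (568767864240 : ℤ) • h.res_cbpa_paa t + (1210396505415 : ℤ) •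
      h.res_cbpa_pac t
  · linear_combination (norm := module) -((8304201 : ℤ) • h.res_bb_bapa t) - (16026579 : ℤ) •
      h.res_pab_bab t + (10895958 : ℤ) • h.res_cbpa_paa t - (26710965 : ℤ) • h.res_cbpa_pac t

theorem aacbp : a (a (c (b (p t)))) = 0 := by
  rcases h.regular with ⟨rfl, hN⟩ | ⟨rfl, hN⟩ <;> refine hN _ ?_
  · linear_combination (norm := module) -((356488368810 : ℤ) • h.res_bb_bapa t) - (572969754490 :
      ℤ) • h.res_pab_bab t + (410608715230 : ℤ) • h.res_cbpa_paa t - (451198975045 : ℤ) •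
      h.res_cbpa_pac t
  · linear_combination (norm := module) (20945628 : ℤ) • h.res_bb_bapa t - (2327292 : ℤ) •
      h.res_pab_bab t - (23854743 : ℤ) • h.res_cbpa_pac t

theorem aaccp : a (a (c (c (p t)))) = 0 := by
  rcases h.regular with ⟨rfl, hN⟩ | ⟨rfl, hN⟩ <;> refine hN _ ?_
  · linear_combination (norm := module) (1919591541810 : ℤ) • h.res_bb_bapa t - (2334318109485 :
      ℤ) • h.res_pab_bab t - (1826645729480 : ℤ) • h.res_cbpa_paa t - (3289827952335 : ℤ) •
      h.res_cbpa_pac t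
  · linear_combination (norm := module) -((11213316 : ℤ) • h.res_bb_bapa t) - (9044703 : ℤ) •
      h.res_pab_bab t + (10895958 : ℤ) • h.res_cbpa_paa t - (15074505 : ℤ) • h.res_cbpa_pac t

theorem acbap : a (c (b (a (p t)))) = 0 := by
  rcases h.regular with ⟨rfl, hN⟩ | ⟨rfl, hN⟩ <;> refine hN _ ?_
  · linear_combination (norm := module) -((3415968697640 : ℤ) • h.res_bb_bapa t) + (4623675993295
      : ℤ) • h.res_pab_bab t + (3153014405795 : ℤ) • h.res_cbpa_paa t + (6943623638125 : ℤ) •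
      h.res_cbpa_pac t
  · linear_combination (norm := module) (21157200 : ℤ) • h.res_bb_bapa t + (9150489 : ℤ) •
      h.res_pab_bab t + (5447979 : ℤ) • h.res_cbpa_paa t - (24701031 : ℤ) • h.res_cbpa_pac t

/-! ### Residual system for words with one q and no p -/

theorem res_cqba_baa : (2 + 32 * e) • q (a (a (a (b t)))) + (19 + 44 * e) • q (a (a (a (c t)))) +
    (18 - 9 * e) • q (a (a (c (b t)))) + (10 + 34 * e) • q (a (a (a (a t)))) + (22 + 17 * e) • q
    (a (c (b (a t)))) - (6 + e) • q (a (a (b (a t)))) - (2 - e) • c (q (a (a (a t)))) = 0 := by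
  have H := h.cqba (a t)
  simp only [map_add, map_sub, map_neg, map_zsmul, map_nsmul, h.bb, h.ca, h.baa, h.bac, h.accc,
    h.nf_cqccc t] at H
  rcases h.sign with he | he <;> linear_combination (norm := (subst he; module)) -H - h.cqaac t +
    e • h.acqac t + h.acqaa t - (1 + 2 * e) • h.qaccb t - (7 + e) • h.qaacc t

theorem nf_bacq : b (a (c (q t))) = (2 + 2 * e) • q (a (a (a t))) + (1 - e) • q (a (b (a t))) + q
    (a (a (b t))) + (1 + e) • q (a (c (b t))) + e • q (c (b (a t))) - 2 • q (c (c (c t))) - (3 + 2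
    * e) • q (a (c (c t))) := by
  simp only [map_add, map_sub, map_zsmul, h.aq, h.bc, h.bq, h.ca, h.bac, h.ccq, h.aacq, h.acqb]
  rcases h.sign with rfl | rfl <;> module

theorem res_ca_aacq : (17 - 8 * e) • q (a (a (c (b t)))) + (68 + 85 * e) • q (a (a (a (c t)))) +
    (40 + 57 * e) • q (a (a (a (a t)))) + (26 + 51 * e) • q (a (a (a (b t)))) + (52 + 47 * e) • q
    (a (c (b (a t)))) - (16 + 8 * e) • q (a (a (b (a t)))) - (2 * e) • c (q (a (a (a t)))) = 0 :=
    by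
  have H := h.ca (a (c (q t)))
  simp only [map_add, map_sub, map_neg, map_zsmul, map_nsmul, h.aq, h.bb, h.bc, h.ca, h.baa,
    h.bab, h.aacq, h.accc, h.cccc, h.nf_bacq t, h.nf_cqaba t, h.nf_cqccc t] at H
  rcases h.sign with he | he <;> linear_combination (norm := (subst he; module)) -H + e • h.cqacc
    t - (1 + e) • h.cqacb t - h.cqaab t - (2 + 2 * e) • h.cqaac t + (1 + e) • h.acqac t - (2 + 4 *
    e) • h.qaccb t + (1 + e) • h.qccba t - (14 + 8 * e) • h.qaacc t

theorem res_aacq_acqb : (18 + 15 * e) • q (a (c (b (a t)))) + (13 - 10 * e) • q (a (a (c (b t))))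
    + (3 + 29 * e) • q (a (a (a (b t)))) + (11 + 32 * e) • q (a (a (a (a t)))) + (15 + 37 * e) • q
    (a (a (a (c t)))) - (7 + e) • q (a (a (b (a t)))) = 0 := by
  have H := h.aacq (b t)
  simp only [map_add, map_sub, map_neg, map_zsmul, map_nsmul, h.aq, h.bb, h.bc, h.ca, h.baa,
    h.bab, h.bac, h.accc, h.acqb, h.cccb, h.cccc, h.nf_aacqa t] at H
  rcases h.sign with he | he <;> linear_combination (norm := (subst he; module)) -H - (1 + e) •
    h.qaccb t - (1 - e) • h.qccba t - (7 + 2 * e) • h.qaacc t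

theorem nf_ccqb : c (c (q (b t))) = e • q (a (a (a t))) + (2 + 2 * e) • q (a (a (c t))) + e • q (a
    (c (b t))) + (1 + e) • a (c (q (a t))) + c (q (a (c t))) + e • c (q (a (a t))) - (3 * e) • q
    (c (c (c t))) - (1 + 4 * e) • q (a (c (c t))) - 3 • q (a (a (b t))) - e • q (c (b (a t))) - (1
    - e) • q (c (c (b t))) - (3 + e) • q (a (b (a t))) := by
  simp only [map_sub, map_neg, map_zsmul, h.bb, h.bab, h.ccq, h.acqb, h.cqab]
  rcases h.sign with rfl | rfl <;> module

theorem nf_bcqb : b (c (q (b t))) = e • q (a (a (a t))) + (3 + 2 * e) • q (a (a (c t))) + (1 + e)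
    • a (c (q (a t))) + c (q (a (c t))) + e • c (q (a (a t))) - (3 * e) • q (c (c (c t))) - (1 + 4
    * e) • q (a (c (c t))) - (3 + e) • q (a (a (b t))) - e • q (c (b (a t))) - q (c (c (b t))) -
    (3 + e) • q (a (b (a t))) := by
  simp only [map_sub, map_neg, map_zsmul, h.aq, h.bb, h.bc, h.ca, h.nf_ccqb t]
  rcases h.sign with rfl | rfl <;> module

theorem nf_cqcba : c (q (c (b (a t)))) = (2 - 3 * e) • q (a (a (c (b t)))) + (2 - 2 * e) • q (a (a
    (b (a t)))) + (3 - 6 * e) • q (a (a (c (c t)))) + e • q (a (c (c (b t)))) + a (c (q (a (a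
    t)))) + e • c (q (a (a (a t)))) - (3 - e) • q (a (a (a (c t)))) - 5 • q (a (a (a (b t)))) - e
    • q (a (a (a (a t)))) - (1 + e) • q (a (c (b (a t)))) := by
  simp only [map_add, map_sub, map_neg, map_zsmul, map_nsmul, h.aq, h.bb, h.bc, h.ca, h.baa,
    h.bab, h.bac, h.cqc, h.accc, h.cccc, h.cqba, h.nf_aacqa t, h.nf_cqaba t]
  rcases h.sign with rfl | rfl <;> module

theorem nf_cqccb : c (q (c (c (b t)))) = (5 + 2 * e) • q (a (a (c (b t)))) + (3 - 6 * e) • q (a (a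
    (c (c t)))) + (11 + 18 * e) • q (a (a (a (c t)))) + (6 + 2 * e) • q (a (a (a (a t)))) + (1 + 2
    * e) • q (a (c (b (a t)))) + (3 + 6 * e) • q (a (a (a (b t)))) - (1 + 8 * e) • q (a (a (b (a
    t)))) - q (c (c (b (a t)))) - e • a (c (q (a (a t)))) - c (q (a (c (b t)))) := by
  simp only [map_add, map_sub, map_neg, map_zsmul, map_nsmul, h.aq, h.bb, h.bc, h.ca, h.baa,
    h.bab, h.bac, h.cqc (c (b t)), h.accc, h.cccb, h.cccc, h.nf_cqcb t, h.nf_aacqa t]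
  rcases h.sign with rfl | rfl <;> module

theorem res_ca_acqb : (42 + 14 * e) • q (a (a (a (b t)))) + (20 + 4 * e) • q (a (a (a (c t)))) +
    (9 - 4 * e) • q (a (a (b (a t)))) + (35 + 15 * e) • q (a (a (a (a t)))) + (25 + 30 * e) • q (a
    (c (b (a t)))) - (7 - 22 * e) • q (a (a (c (b t)))) - (4 - 3 * e) • c (q (a (a (a t)))) = 0 :=
    by
  have H := h.ca (c (q (b t)))
  simp only [map_add, map_sub, map_neg, map_zsmul, map_nsmul, h.aq, h.bb, h.bc (c t), h.ca t, h.ca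
    (a (a t)), h.ca (a (b t)), h.ca (a (c t)), h.ca (b (a t)), h.ca (c (c t)), h.baa, h.bab,
    h.bac, h.accc, h.acqb, h.cccb, h.cccc, h.nf_bcqb t, h.nf_aacqa t, h.nf_cacqa t, h.nf_cqaba t,
    h.nf_cqcba t, h.nf_cqccb t, h.nf_cqccc t] at H
  rcases h.sign with he | he <;> linear_combination (norm := (subst he; module)) -H + (1 + e) •
    h.cqacc t + (2 + e) • h.cqaab t - (2 : ℤ) • h.cqaac t - (1 - e) • h.acqac t + (1 + e) •
    h.acqaa t - (3 - e) • h.qaccb t + (1 + 2 * e) • h.qccba t - (3 + 11 * e) • h.qaacc t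

theorem res_ccq_cqba : (6 - 13 * e) • q (a (a (c (b t)))) + (11 + 18 * e) • q (a (a (b (a t)))) +
    2 • c (q (a (a (a t)))) - (90 + 74 * e) • q (a (a (a (c t)))) - (43 + 24 * e) • q (a (a (a (b
    t)))) - (55 + 40 * e) • q (a (a (a (a t)))) - (43 + 48 * e) • q (a (c (b (a t)))) = 0 := by
  have H := h.ccq (b (a t))
  simp only [map_add, map_sub, map_neg, map_zsmul, map_nsmul, h.aq, h.bb, h.bc, h.ca t, h.ca (a (a
    t)), h.ca (a (b t)), h.ca (a (c t)), h.ca (b (a t)), h.ca (c (b t)), h.ca (c (c t)), h.baa,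
    h.bab, h.bac, h.accc, h.cccc, h.cqba, h.nf_aacqa t, h.nf_cacqa t, h.nf_ccqaa t, h.nf_cqaba t,
    h.nf_cqccc t] at H
  rcases h.sign with he | he <;> linear_combination (norm := (subst he; module)) -H - h.cqacc t +
    e • h.cqacb t + (1 + e) • h.cqaab t + (2 + 2 * e) • h.cqaac t - (1 + e) • h.acqac t + (4 + 3 *
    e) • h.qaccb t - e • h.qccba t + (8 + 12 * e) • h.qaacc t

theorem nf_bqccb : b (q (c (c (b t)))) = (5 + 2 * e) • q (a (a (c (b t)))) + (3 - 6 * e) • q (a (a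
    (c (c t)))) + (11 + 18 * e) • q (a (a (a (c t)))) + (6 + 2 * e) • q (a (a (a (a t)))) + (2 + 2
    * e) • q (a (c (b (a t)))) + (3 + 6 * e) • q (a (a (a (b t)))) - (1 + 8 * e) • q (a (a (b (a
    t)))) - q (c (c (b (a t)))) - e • a (c (q (a (a t)))) - c (q (a (c (b t)))) := by
  simp only [map_add, map_sub, map_zsmul, h.bc, h.bq, h.cccb, h.nf_cqccb t]
  rcases h.sign with rfl | rfl <;> module

theorem res_bac_acqb : (11 + 49 * e) • q (a (a (a (b t)))) + (10 + 51 * e) • q (a (a (a (c t)))) +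
    (15 + 48 * e) • q (a (a (a (a t)))) + (22 - 7 * e) • q (a (a (c (b t)))) + (30 + 28 * e) • q
    (a (c (b (a t)))) - (2 + e) • q (a (a (b (a t)))) - (4 - 3 * e) • c (q (a (a (a t)))) = 0 :=
    by
  have H := h.bac (q (b t))
  simp only [map_add, map_sub, map_neg, map_zsmul, map_nsmul, h.aq, h.bb, h.bc, h.bq (b t), h.bq
    (a (a (a t))), h.bq (a (a (b t))), h.bq (a (a (c t))), h.bq (a (c (b t))), h.bq (a (c (c t))),
    h.bq (c (b (a t))), h.ca, h.baa t, h.baa (a t), h.baa (b t), h.bab, h.bac t, h.bac (b t),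
    h.bac (c t), h.accc, h.acqb, h.cccb, h.cccc, h.cqab, h.nf_baac t, h.nf_ccqb t, h.nf_aacqa t,
    h.nf_bacqa t, h.nf_bqaba t, h.nf_bqccb t, h.nf_bqccc t, h.nf_cqcba t] at H
  rcases h.sign with he | he <;> linear_combination (norm := (subst he; module)) -H + (1 + e) •
    h.cqacc t + (2 + e) • h.cqaab t - (2 : ℤ) • h.cqaac t - (1 - 2 * e) • h.acqac t + e • h.acqaa
    t - (5 - 2 * e) • h.qaccb t - (2 - 5 * e) • h.qccba t - (9 + 6 * e) • h.qaacc t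

theorem nf_cacq : c (a (c (q t))) = (3 + 2 * e) • q (a (a (a t))) + (1 + 2 * e) • q (a (a (c t)))
    + q (a (c (b t))) + e • q (c (b (a t))) - (3 + e) • q (c (c (c t))) - (5 + 3 * e) • q (a (c (c
    t))) - e • q (a (b (a t))) - e • q (a (a (b t))) - e • q (c (c (b t))) := by
  simp only [map_add, map_sub, map_neg, map_zsmul, h.aq, h.bb, h.bc, h.ca, h.ccq, h.aacq, h.acqb]
  rcases h.sign with rfl | rfl <;> module

theorem res_bac_cqc : (13 + 7 * e) • q (a (a (b (a t)))) + (2 * e) • c (q (a (a (a t)))) - (58 +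
    83 * e) • q (a (a (a (c t)))) - (21 - 11 * e) • q (a (a (c (b t)))) - (24 + 58 * e) • q (a (a
    (a (b t)))) - (36 + 61 * e) • q (a (a (a (a t)))) - (51 + 47 * e) • q (a (c (b (a t)))) = 0 :=
    by
  have H := h.bac (q (c t))
  simp only [map_add, map_sub, map_neg, map_zsmul, map_nsmul, h.aq, h.bb, h.bc, h.bq (c t), h.bq
    (a (a (a t))), h.bq (a (a (b t))), h.bq (a (a (c t))), h.bq (a (c (b t))), h.bq (a (c (c t))),
    h.ca t, h.ca (a t), h.ca (b t), h.ca (c t), h.ca (a (a t)), h.ca (a (b t)), h.ca (a (c t)),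
    h.ca (b (a t)), h.ca (c (b t)), h.ca (c (c t)), h.baa t, h.baa (a t), h.baa (b t), h.bab,
    h.bac t, h.bac (b t), h.bac (c t), h.cqc t, h.aacq t, h.accc, h.cccb, h.cccc, h.cqab,
    h.nf_baac t, h.nf_cacq t, h.nf_ccqa t, h.nf_cqcb t, h.nf_cqcc t, h.nf_aacqa t, h.nf_bacqa t,
    h.nf_bqaba t, h.nf_bqccb t, h.nf_bqccc t] at H
  rcases h.sign with he | he <;> linear_combination (norm := (subst he; module)) -H - e • h.cqacc
    t + (1 + e) • h.cqacb t - e • h.cqaab t + (2 + 2 * e) • h.cqaac t - (1 + e) • h.acqac t + (2 +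
    4 * e) • h.qaccb t - (1 + e) • h.qccba t + (15 + 7 * e) • h.qaacc t

/-- Seven relations between the seven words cqaaa, qaaaa, qaaab, qaaac, qaaba, qaacb, qacba. The
third factors in `regular`, 661715 for e = 1 and 653 for e = -1, clear the denominators of the
inverse matrix. -/
theorem cqaaa : c (q (a (a (a t)))) = 0 := by
  rcases h.regular with ⟨rfl, hN⟩ | ⟨rfl, hN⟩ <;> refine hN _ ?_
  · linear_combination (norm := module) -((1684960721766 : ℤ) • h.res_cqba_baa t) +
      (24372530643335 : ℤ) • h.res_ca_aacq t + (3552170151551 : ℤ) • h.res_aacq_acqb t -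
      (4763180742733 : ℤ) • h.res_ca_acqb t + (11793698368487 : ℤ) • h.res_ccq_cqba t +
      (5988146021144 : ℤ) • h.res_bac_acqb t + (15066323034553 : ℤ) • h.res_bac_cqc t
  · linear_combination (norm := module) -((203185422 : ℤ) • h.res_cqba_baa t) + (79750737 : ℤ) •
      h.res_ca_aacq t + (1135874421 : ℤ) • h.res_aacq_acqb t + (549077859 : ℤ) • h.res_ca_acqb t +
      (55889757 : ℤ) • h.res_ccq_cqba t - (398111274 : ℤ) • h.res_bac_acqb t - (117928305 : ℤ) •
      h.res_bac_cqc t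

theorem qaaaa : q (a (a (a (a t)))) = 0 := by
  rcases h.regular with ⟨rfl, hN⟩ | ⟨rfl, hN⟩ <;> refine hN _ ?_
  · linear_combination (norm := module) (662999592591 : ℤ) • h.res_cqba_baa t - (1576904297290 :
      ℤ) • h.res_ca_aacq t + (589677936974 : ℤ) • h.res_aacq_acqb t + (781454271353 : ℤ) •
      h.res_ca_acqb t - (816271174922 : ℤ) • h.res_ccq_cqba t - (1136366566734 : ℤ) •
      h.res_bac_acqb t - (606589473763 : ℤ) • h.res_bac_cqc t
  · linear_combination (norm := module) -((91314135 : ℤ) • h.res_cqba_baa t) + (70298118 : ℤ) •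
      h.res_ca_aacq t + (426377358 : ℤ) • h.res_aacq_acqb t + (215391231 : ℤ) • h.res_ca_acqb t +
      (10095030 : ℤ) • h.res_ccq_cqba t - (143349426 : ℤ) • h.res_bac_acqb t - (34781967 : ℤ) •
      h.res_bac_cqc t

theorem qaaab : q (a (a (a (b t)))) = 0 := by
  rcases h.regular with ⟨rfl, hN⟩ | ⟨rfl, hN⟩ <;> refine hN _ ?_
  · linear_combination (norm := module) -((1027332739209 : ℤ) • h.res_cqba_baa t) - (312317234775
      : ℤ) • h.res_ca_aacq t - (517210482341 : ℤ) • h.res_aacq_acqb t - (759228618827 : ℤ) •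
      h.res_ca_acqb t + (3597500298 : ℤ) • h.res_ccq_cqba t + (1293013885646 : ℤ) • h.res_bac_acqb
      t - (562688471268 : ℤ) • h.res_bac_cqc t
  · linear_combination (norm := module) (685452537 : ℤ) • h.res_cqba_baa t - (340202511 : ℤ) •
      h.res_ca_aacq t - (4026173283 : ℤ) • h.res_aacq_acqb t - (1938704625 : ℤ) • h.res_ca_acqb t
      - (136007586 : ℤ) • h.res_ccq_cqba t + (1403943354 : ℤ) • h.res_bac_acqb t + (367275546 : ℤ)
      • h.res_bac_cqc t

theorem qaaac : q (a (a (a (c t)))) = 0 := by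
  rcases h.regular with ⟨rfl, hN⟩ | ⟨rfl, hN⟩ <;> refine hN _ ?_
  · linear_combination (norm := module) (557752175197 : ℤ) • h.res_cqba_baa t + (738308908190 : ℤ)
      • h.res_ca_aacq t + (52631922168 : ℤ) • h.res_aacq_acqb t - (351610480039 : ℤ) •
      h.res_ca_acqb t + (821642784956 : ℤ) • h.res_ccq_cqba t - (59941911358 : ℤ) • h.res_bac_acqb
      t - (10233984866 : ℤ) • h.res_bac_cqc t
  · linear_combination (norm := module) -((103244625 : ℤ) • h.res_cqba_baa t) + (45152316 : ℤ) •
      h.res_ca_aacq t + (692886150 : ℤ) • h.res_aacq_acqb t + (328455567 : ℤ) • h.res_ca_acqb t +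
      (17436870 : ℤ) • h.res_ccq_cqba t - (247603554 : ℤ) • h.res_bac_acqb t - (65525922 : ℤ) •
      h.res_bac_cqc t

theorem qaaba : q (a (a (b (a t)))) = 0 := by
  rcases h.regular with ⟨rfl, hN⟩ | ⟨rfl, hN⟩ <;> refine hN _ ?_
  · linear_combination (norm := module) (3179360702861 : ℤ) • h.res_cqba_baa t + (1200932662265 :
      ℤ) • h.res_ca_aacq t + (983842410264 : ℤ) • h.res_aacq_acqb t + (63350501823 : ℤ) •
      h.res_ca_acqb t + (2636548831413 : ℤ) • h.res_ccq_cqba t - (2301118889244 : ℤ) •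
      h.res_bac_acqb t - (964820011428 : ℤ) • h.res_bac_cqc t
  · linear_combination (norm := module) -((80852013 : ℤ) • h.res_cqba_baa t) + (26889489 : ℤ) •
      h.res_ca_aacq t + (484010802 : ℤ) • h.res_aacq_acqb t + (243473769 : ℤ) • h.res_ca_acqb t +
      (26705943 : ℤ) • h.res_ccq_cqba t - (175469976 : ℤ) • h.res_bac_acqb t - (63139824 : ℤ) •
      h.res_bac_cqc t

theorem qaacb : q (a (a (c (b t)))) = 0 := by
  rcases h.regular with ⟨rfl, hN⟩ | ⟨rfl, hN⟩ <;> refine hN _ ?_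
  · linear_combination (norm := module) -((791622548451 : ℤ) • h.res_cqba_baa t) + (1528937626650
      : ℤ) • h.res_ca_aacq t - (608938526469 : ℤ) • h.res_aacq_acqb t - (356776753298 : ℤ) •
      h.res_ca_acqb t - (274888447428 : ℤ) • h.res_ccq_cqba t + (1634965323789 : ℤ) •
      h.res_bac_acqb t + (2047109085098 : ℤ) • h.res_bac_cqc t
  · linear_combination (norm := module) (624331719 : ℤ) • h.res_cqba_baa t - (294774876 : ℤ) •
      h.res_ca_aacq t - (3687898005 : ℤ) • h.res_aacq_acqb t - (1771585992 : ℤ) • h.res_ca_acqb t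
      - (135273402 : ℤ) • h.res_ccq_cqba t + (1285647957 : ℤ) • h.res_bac_acqb t + (334237266 : ℤ)
      • h.res_bac_cqc t

theorem qacba : q (a (c (b (a t)))) = 0 := by
  rcases h.regular with ⟨rfl, hN⟩ | ⟨rfl, hN⟩ <;> refine hN _ ?_
  · linear_combination (norm := module) (96130464584 : ℤ) • h.res_cqba_baa t + (1346352166320 : ℤ)
      • h.res_ca_aacq t + (108795636866 : ℤ) • h.res_aacq_acqb t + (319807920327 : ℤ) •
      h.res_ca_acqb t + (429580960242 : ℤ) • h.res_ccq_cqba t - (385137868661 : ℤ) •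
      h.res_bac_acqb t + (932171464203 : ℤ) • h.res_bac_cqc t
  · linear_combination (norm := module) -((403984746 : ℤ) • h.res_cqba_baa t) + (188501742 : ℤ) •
      h.res_ca_aacq t + (2434187052 : ℤ) • h.res_aacq_acqb t + (1183412835 : ℤ) • h.res_ca_acqb t
      + (110311146 : ℤ) • h.res_ccq_cqba t - (859270599 : ℤ) • h.res_bac_acqb t - (229707819 : ℤ)
      • h.res_bac_cqc t

/-! ### Residual system for words with two letters from p and q -/

theorem res_qqba_bab : -((2 - 4 * e) • q (q (a (a (b t))))) - (2 - e) • q (q (a (b (a t)))) = 0 :=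
    by
  have H := h.qqba (b t)
  simp only [map_sub, map_neg, map_zsmul, h.bb, h.bc, h.ca, h.bab] at H
  rcases h.sign with rfl | rfl <;> linear_combination (norm := module) -H - h.qqacb t - (2 : ℤ) •
    h.qqaaa t - h.qqacc t - (3 : ℤ) • h.qqaac t

theorem res_qcbp_cbpa : -((60 - 76 * e) • q (q (a (a (b t))))) - (41 - 39 * e) • q (q (a (b (a
    t)))) = 0 := by
  have H := h.qcbp (a t)
  simp only [map_add, map_sub, map_zsmul, h.ca, h.cbpa] at H
  rcases h.sign with he | he <;> linear_combination (norm := (subst he; module)) -H - e • h.qccbp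
    t - (2 * e) • h.qaabp t + (1 + e) • h.qcccp t - e • h.qaccp t - (1 + e) • h.qqacb t + (1 + e)
    • h.qcbap t - (4 + 3 * e) • h.qqaaa t + (3 * e) • h.qaaap t + (3 - 3 * e) • h.qqacc t + e •
    h.qabpa t - (1 + e) • h.qabap t + (11 - 2 * e) • h.qqaac t + (3 - e) • h.qaacp t

theorem res_cqap_pc : -((22 - 45 * e) • q (q (a (b (a t))))) - (63 - 46 * e) • q (q (a (a (b t))))
    = 0 := by
  have H := h.cqap (c t)
  simp only [map_sub, map_neg, map_zsmul, h.bb, h.bc, h.ca, h.pc, h.bab, h.qqcc, h.nf_cqabp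
    t] at H
  rcases h.sign with he | he <;> linear_combination (norm := (subst he; module)) -H + (1 + 2 * e)
    • h.qaabp t - (1 - 2 * e) • h.qaccp t + (1 + 2 * e) • h.qcbap t - (8 - e) • h.qqaaa t - (2 - 4
    * e) • h.qqcba t + (1 + 2 * e) • h.qaaap t - (4 + 4 * e) • h.qqacc t + (1 - 2 * e) • h.qabpa t
    - (2 : ℤ) • h.qabap t + (2 + 3 * e) • h.qacbp t + (21 - 3 * e) • h.qqaac t + (4 : ℤ) • h.qaacp
    t

/-- Three relations for the two words qqaab and qqaba. For either sign the 2×2 minors of the system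
have greatest common divisor 1, so it can be solved over the integers: for e = 1 the combination
with coefficients 139, -12, 5 is qqaab itself. The multipliers are such coefficients times the
product in `regular`, so this system contributes no factor of its own. -/
theorem qqaab : q (q (a (a (b t)))) = 0 := by
  rcases h.regular with ⟨rfl, hN⟩ | ⟨rfl, hN⟩ <;> refine hN _ ?_
  · linear_combination (norm := module) (755461797824335 : ℤ) • h.res_qqba_bab t - (65219723553180
      : ℤ) • h.res_qcbp_cbpa t + (27174884813825 : ℤ) • h.res_cqap_pc t
  · linear_combination (norm := module) (8090248815 : ℤ) • h.res_qqba_bab t - (1558121994 : ℤ) •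
      h.res_qcbp_cbpa t + (1498194225 : ℤ) • h.res_cqap_pc t

theorem qqaba : q (q (a (b (a t)))) = 0 := by
  rcases h.regular with ⟨rfl, hN⟩ | ⟨rfl, hN⟩ <;> refine hN _ ?_
  · linear_combination (norm := module) -((309793686877605 : ℤ) • h.res_qqba_bab t) +
      (27174884813825 : ℤ) • h.res_qcbp_cbpa t - (10869953925530 : ℤ) • h.res_cqap_pc t
  · linear_combination (norm := module) -((539349921 : ℤ) • h.res_qqba_bab t) + (119855538 : ℤ) •
      h.res_qcbp_cbpa t - (119855538 : ℤ) • h.res_cqap_pc t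

end TwistedRelations

/-! ### Words of length five -/

namespace TwistedRelations

variable {M : Type*} [AddCommGroup M] {e : ℤ} {a b c p q : M →+ M}
  (h : TwistedRelations e a b c p q) (t : M)

/-- The irreducible words of length 2, applied to `t`. -/
def irreducible2 (a b c p q : M →+ M) (t : M) : List M :=
  [a (a t), a (b t), a (c t), a (p t), b (a t), b (p t), c (b t), c (c t), c (p t), c (q t), p (a
   t), q (a t), q (b t), q (c t), q (p t), q (q t)]

/-- The irreducible words of length 3, applied to `t`. -/
def irreducible3 (a b c p q : M →+ M) (t : M) : List M :=
  [a (a (a t)), a (a (b t)), a (a (c t)), a (a (p t)), a (b (a t)), a (b (p t)), a (c (b t)), a (c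
   (c t)), a (c (p t)), a (c (q t)), a (p (a t)), b (a (p t)), b (p (a t)), c (b (a t)), c (b (p
   t)), c (c (b t)), c (c (c t)), c (c (p t)), c (p (a t)), c (q (a t)), c (q (b t)), c (q (p t)),
   q (a (a t)), q (a (b t)), q (a (c t)), q (a (p t)), q (b (a t)), q (b (p t)), q (c (b t)), q (c
   (c t)), q (c (q t)), q (p (a t)), q (q (a t)), q (q (b t)), q (q (c t))]

/-- The irreducible words of length 4, applied to `t`. -/
def irreducible4 (a b c p q : M →+ M) (t : M) : List M :=
  [a (a (a (a t))), a (a (a (b t))), a (a (a (c t))), a (a (a (p t))), a (a (b (a t))), a (a (b (p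
   t))), a (a (c (b t))), a (a (c (c t))), a (a (c (p t))), a (a (p (a t))), a (b (a (p t))), a (b
   (p (a t))), a (c (b (a t))), a (c (b (p t))), a (c (c (b t))), a (c (c (p t))), a (c (q (a
   t))), c (b (a (p t))), c (c (b (a t))), c (c (b (p t))), c (c (c (p t))), c (c (p (a t))), c (q
   (a (a t))), c (q (a (c t))), c (q (p (a t))), q (a (a (a t))), q (a (a (b t))), q (a (a (c
   t))), q (a (b (a t))), q (a (b (p t))), q (a (c (b t))), q (a (c (c t))), q (a (c (p t))), q (a
   (p (a t))), q (b (a (p t))), q (b (p (a t))), q (c (b (a t))), q (c (c (b t))), q (c (c (c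
   t))), q (q (a (a t))), q (q (a (b t))), q (q (a (c t))), q (q (c (b t)))]

include h

set_option linter.unusedSimpArgs false

set_option maxHeartbeats 1000000 in
-- With the four residual systems solved, no irreducible word of length five is left, so a letter in
-- front of an irreducible word of length four always rewrites to 0.
theorem apply_irreducible4 {f : M →+ M} (hf : f ∈ ({a, b, c, p, q} : Set (M →+ M))) :
    ∀ w ∈ irreducible4 a b c p q t, f w = 0 := by
  simp only [irreducible4, List.forall_mem_cons, List.not_mem_nil, false_imp_iff, forall_const,
    and_true]
  rcases hf with rfl | rfl | rfl | rfl | rfl <;>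
    simp only [map_add, map_sub, map_neg, map_zsmul, map_nsmul, map_zero, h.bb, h.bc, h.ca, h.pb,
      h.pc, h.bq, h.aq, h.pq, h.pp, h.qqq, h.pab, h.bac, h.qqp, h.bab, h.paa, h.baa, h.cqc, h.qcp,
      h.pac, h.cqq, h.pap, h.ccq, h.qqbp, h.qqcq, h.qqap, h.qcqp, h.qcbp, h.cccb, h.acpa, h.cccc,
      h.cqab, h.accc, h.qccp, h.bapa, h.cbpa, h.qcqb, h.cqap, h.qaap, h.cqbp, h.acqb, h.cqba,
      h.aacq, h.qcqa, h.qacq, h.qqcc, h.qqba, h.acqp, h.qqabp, h.qqacp, h.accba, h.accpa, h.aaccb,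
      h.aacba, h.accbp, h.aabap, h.aaaba, h.aaacb, h.cqacc, h.qccbp, h.aabpa, h.cqacb, h.aaabp,
      h.aaaap, h.ccbap, h.qaabp, h.qcccp, h.qaccp, h.cqaab, h.cqacp, h.cqaac, h.acqac, h.acqaa,
      h.qaccb, h.qqacb, h.qcbap, h.aaapa, h.qqaaa, h.qqcba, h.qaaap, h.qqacc, h.qabpa, h.qabap,
      h.qccba, h.qacbp, h.qaacc, h.qqaac, h.qaacp, h.cccpa, h.aaaaa, h.aaaab, h.aaaac, h.aaacc,
      h.aaacp, h.aacbp, h.aaccp, h.acbap, h.cqaaa, h.qaaaa, h.qaaab, h.qaaac, h.qaaba, h.qaacb,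
      h.qacba, h.qqaab, h.qqaba, smul_zero, neg_zero, add_zero, sub_zero, and_self]

set_option maxHeartbeats 1000000 in
-- The word `f w` rewrites to a combination of irreducible words of length four, and `F` is
-- additive. Keeping `F` abstract allows it to stand for the letters further left, which need not be
-- normalised.
theorem apply_irreducible3 {F f : M →+ M}
    (hF : ∀ w ∈ irreducible4 a b c p q t, F w = 0) (hf : f ∈ ({a, b, c, p, q} : Set (M →+ M))) :
    ∀ w ∈ irreducible3 a b c p q t, F (f w) = 0 := by
  simp only [irreducible3, irreducible4, List.forall_mem_cons, List.not_mem_nil, false_imp_iff,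
    forall_const, and_true] at hF ⊢
  rcases hf with rfl | rfl | rfl | rfl | rfl <;>
    simp only [map_add, map_sub, map_neg, map_zsmul, map_nsmul, map_zero, h.bb, h.bc, h.ca, h.pb,
      h.pc, h.bq, h.aq, h.pq, h.pp, h.qqq, h.pab, h.bac, h.qqp, h.bab, h.paa, h.baa, h.cqc, h.qcp,
      h.pac, h.cqq, h.pap, h.ccq, h.qqbp, h.qqcq, h.qqap, h.qcqp, h.qcbp, h.cccb, h.acpa, h.cccc,
      h.cqab, h.accc, h.qccp, h.bapa, h.cbpa, h.qcqb, h.cqap, h.qaap, h.cqbp, h.acqb, h.cqba,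
      h.aacq, h.qcqa, h.qacq, h.qqcc, h.qqba, h.acqp, hF, smul_zero, neg_zero, add_zero, sub_zero,
      and_self]

theorem apply_irreducible2 {F f : M →+ M}
    (hF : ∀ w ∈ irreducible3 a b c p q t, F w = 0) (hf : f ∈ ({a, b, c, p, q} : Set (M →+ M))) :
    ∀ w ∈ irreducible2 a b c p q t, F (f w) = 0 := by
  simp only [irreducible2, irreducible3, List.forall_mem_cons, List.not_mem_nil, false_imp_iff,
    forall_const, and_true] at hF ⊢
  rcases hf with rfl | rfl | rfl | rfl | rfl <;>
    simp only [map_add, map_sub, map_neg, map_zsmul, map_nsmul, map_zero, h.bb, h.bc, h.ca, h.pb,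
      h.pc, h.bq, h.aq, h.pq, h.pp, h.qqq, h.pab, h.bac, h.qqp, h.bab, h.paa, h.baa, h.cqc, h.qcp,
      h.pac, h.cqq, h.pap, h.ccq, hF, smul_zero, neg_zero, add_zero, sub_zero, and_self]

theorem apply_two {F f g : M →+ M}
    (hF : ∀ w ∈ irreducible2 a b c p q t, F w = 0) (hf : f ∈ ({a, b, c, p, q} : Set (M →+ M)))
    (hg : g ∈ ({a, b, c, p, q} : Set (M →+ M))) : F (f (g t)) = 0 := by
  simp only [irreducible2, List.forall_mem_cons, List.not_mem_nil, false_imp_iff, forall_const,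
    and_true] at hF
  rcases hf with rfl | rfl | rfl | rfl | rfl <;> rcases hg with rfl | rfl | rfl | rfl | rfl <;>
    simp only [map_add, map_sub, map_neg, map_zsmul, map_nsmul, map_zero, h.bb, h.bc, h.ca, h.pb,
      h.pc, h.bq, h.aq, h.pq, h.pp, hF, smul_zero, neg_zero, add_zero, sub_zero]

/-- Every word of length five in the letters `a`, `b`, `c`, `p`, `q` vanishes. -/
theorem apply_five {f : Fin 5 → M →+ M} (hf : ∀ i, f i ∈ ({a, b, c, p, q} : Set (M →+ M))) :
    f 0 (f 1 (f 2 (f 3 (f 4 t)))) = 0 :=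
  -- The word is normalised from its right end: its suffixes of length two, three and four are
  -- successively replaced by combinations of irreducible words, and the letters to the left form
  -- `F`.
  h.apply_two (F := (f 0).comp ((f 1).comp (f 2))) t
    (h.apply_irreducible2 (F := (f 0).comp (f 1)) t
      (h.apply_irreducible3 t (h.apply_irreducible4 t (hf 0)) (hf 1)) (hf 2)) (hf 3) (hf 4)

end TwistedRelations

/-! ### The quadratic algebras -/

/-- The coefficient of the word `x y` in an element of the free algebra. -/
noncomputable def FreeAlgebra.pairCoeff (K : Type*) {X : Type*} [Field K] [DecidableEq X] (x y : X) :
    FreeAlgebra K X →ₗ[K] K :=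
  Matrix.entryLinearMap K K (0 : Fin 3) (2 : Fin 3) ∘ₗ
    (FreeAlgebra.lift K fun z : X =>
      !![0, if z = x then (1 : K) else 0, 0; 0, 0, if z = y then 1 else 0; 0, 0, 0]).toLinearMap

/-- Letters go to strictly upper triangular 3×3 matrices, in which x marks the step 0 → 1 and y the
step 1 → 2. The entry (0, 2) therefore sees only the word x y. -/
theorem FreeAlgebra.pairCoeff_mul {K X : Type*} [Field K] [DecidableEq X] (x y z z' : X) :
    FreeAlgebra.pairCoeff K x y (FreeAlgebra.ι K z * FreeAlgebra.ι K z') =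
      if z = x ∧ z' = y then 1 else 0 := by
  by_cases hx : z = x <;> by_cases hy : z' = y <;> simp [FreeAlgebra.pairCoeff, hx, hy]

namespace BlowUp

/-- Three letters for every label in `Fin m`, and `t` letters without a label. -/
abbrev Gen (m t : ℕ) := (Fin 3 × Fin m) ⊕ Fin t

/-- One relation for every leading word: a pair of labelled letters, a labelled and an unlabelled
letter, or a pair of unlabelled letters. -/
abbrev RelIndex (m t : ℕ) := (Fin 3 × Fin m × Fin m) ⊕ (Fin 2 × Fin m × Fin t) ⊕ Fin t

variable {R : Type*} [Ring R] {m t : ℕ}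

/-- The value of the `k`-th unlabelled letter, and `0` if there is no such letter. -/
def extra (g : Gen m t → R) (k : ℕ) : R :=
  if h : k < t then g (.inr ⟨k, h⟩) else 0

/-- The relations between the values `g` of the generators. -/
def relation (e : ℤ) (g : Gen m t → R) : RelIndex m t → R
  | .inl (i, w, w') =>
    ![g (.inl (1, w)) * g (.inl (1, w')) + g (.inl (0, w)) * g (.inl (2, w')),
      g (.inl (1, w)) * g (.inl (2, w')) - g (.inl (2, w)) * g (.inl (2, w')) +
        e • (g (.inl (0, w)) * g (.inl (0, w'))),
      g (.inl (2, w)) * g (.inl (0, w')) - e • (g (.inl (0, w)) * g (.inl (1, w')))] i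
  | .inr (.inl (i, w, k)) =>
    if (k : ℕ) = 0 then
      ![g (.inl (1, w)) * g (.inr k) - g (.inl (2, w)) * g (.inr k) - g (.inr k) * g (.inl (1, w)) -
          g (.inr k) * g (.inl (0, w)),
        g (.inl (0, w)) * g (.inr k) + e • (g (.inr k) * g (.inl (2, w))) +
          e • (g (.inr k) * g (.inl (0, w)))] i
    else
      ![g (.inr k) * g (.inl (1, w)) - g (.inl (1, w)) * g (.inr k) + g (.inl (2, w)) * g (.inr k) -
          e • (g (.inl (0, w)) * g (.inr k)),
        g (.inr k) * g (.inl (2, w)) - g (.inl (1, w)) * g (.inr k)] i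
  -- In terms of the letters this is qq = pq for `k = 0` and pp = qp + pq otherwise. Writing pq
  -- instead of qq in the latter keeps qq out of it, so that qq and pp can be leading words. For `t
  -- = 1` the letter p is 0 and the only relation of this kind is qq = 0.
  | .inr (.inr k) =>
    if (k : ℕ) = 0 then extra g 0 * extra g 0 - extra g 1 * extra g 0
    else extra g 1 * extra g 1 - extra g 0 * extra g 1 - extra g 1 * extra g 0

/-- The leading word of a relation. -/
def lead : RelIndex m t → Gen m t × Gen m t
  | .inl (i, w, w') => (.inl (![1, 1, 2] i, w), .inl (![1, 2, 0] i, w'))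
  | .inr (.inl (i, w, k)) =>
    if (k : ℕ) = 0 then (.inl (![1, 0] i, w), .inr k) else (.inr k, .inl (![1, 2] i, w))
  | .inr (.inr k) => (.inr k, .inr k)

theorem map_relation {R' : Type*} [Ring R'] (φ : R →+* R') (e : ℤ) (g : Gen m t → R)
    (i : RelIndex m t) : φ (relation e g i) = relation e (fun x => φ (g x)) i := by
  rcases i with ⟨i, w, w'⟩ | ⟨i, w, k⟩ | k
  · fin_cases i <;> simp [relation]
  · by_cases hk : (k : ℕ) = 0 <;> fin_cases i <;> simp [relation, hk]
  · by_cases hk : (k : ℕ) = 0 <;> simp [relation, extra, hk, apply_dite φ]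

/-! ### Linear independence by leading words -/

section Linear

variable {K X : Type*} [Field K]

theorem ι_mul_ι_mem (x y : X) :
    FreeAlgebra.ι K x * FreeAlgebra.ι K y ∈ freeHomogeneous K X 2 :=
  Submodule.subset_span ⟨![x, y], by simp [List.ofFn_succ]⟩

theorem relation_mem (e : ℤ) (g : Gen m t → X) (i : RelIndex m t) :
    relation e (fun x => FreeAlgebra.ι K (g x)) i ∈ freeHomogeneous K X 2 := by
  have hx : ∀ k l : ℕ, extra (fun x => FreeAlgebra.ι K (g x)) k *
      extra (fun x => FreeAlgebra.ι K (g x)) l ∈ freeHomogeneous K X 2 := by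
    intro k l
    unfold extra
    split_ifs
    · exact ι_mul_ι_mem _ _
    all_goals simp
  rcases i with ⟨i, w, w'⟩ | ⟨i, w, k⟩ | k
  · fin_cases i <;> simp only [relation] <;>
    repeat' first
      | exact ι_mul_ι_mem _ _ | apply add_mem | apply sub_mem | apply neg_mem | apply zsmul_mem
  · by_cases hk : (k : ℕ) = 0 <;> fin_cases i <;> simp only [relation, hk, if_true, if_false] <;>
    repeat' first
      | exact ι_mul_ι_mem _ _ | apply add_mem | apply sub_mem | apply neg_mem | apply zsmul_mem
  · by_cases hk : (k : ℕ) = 0 <;> simp only [relation, hk, if_true, if_false]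
    · exact sub_mem (hx _ _) (hx _ _)
    · exact sub_mem (sub_mem (hx _ _) (hx _ _)) (hx _ _)

section

variable [DecidableEq X] {g : Gen m t → X} (hg : Function.Injective g) (k l : ℕ)
include hg

theorem pairCoeff_extra (a b : Fin t) :
    FreeAlgebra.pairCoeff K (g (.inr a)) (g (.inr b)) (extra (fun x => FreeAlgebra.ι K (g x)) k *
      extra (fun x => FreeAlgebra.ι K (g x)) l) = if (a : ℕ) = k ∧ (b : ℕ) = l then 1 else 0 := by
  by_cases hk : k < t <;> by_cases hl : l < t <;>
    simp only [extra, hk, hl, dite_true, dite_false, zero_mul, mul_zero, map_zero,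
      FreeAlgebra.pairCoeff_mul, hg.eq_iff, Sum.inr.injEq, Fin.ext_iff, eq_comm]
  all_goals
    rw [if_neg]
    omega

theorem pairCoeff_extra_inl_left (x : Fin 3 × Fin m) (y : Gen m t) :
    FreeAlgebra.pairCoeff K (g (.inl x)) (g y) (extra (fun x => FreeAlgebra.ι K (g x)) k *
      extra (fun x => FreeAlgebra.ι K (g x)) l) = 0 := by
  by_cases hk : k < t <;> by_cases hl : l < t <;>
    simp [extra, hk, hl, FreeAlgebra.pairCoeff_mul, hg.eq_iff]

theorem pairCoeff_extra_inl_right (x : Fin 3 × Fin m) (y : Gen m t) :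
    FreeAlgebra.pairCoeff K (g y) (g (.inl x)) (extra (fun x => FreeAlgebra.ι K (g x)) k *
      extra (fun x => FreeAlgebra.ι K (g x)) l) = 0 := by
  by_cases hk : k < t <;> by_cases hl : l < t <;>
    simp [extra, hk, hl, FreeAlgebra.pairCoeff_mul, hg.eq_iff]

/-- Each leading word occurs in its own relation with coefficient 1 and in no other relation, so the
coefficient matrix is the identity. The bound on `t` ensures that the unlabelled letters are at most
q and p; a third one would repeat the relation for pp. -/
theorem pairCoeff_lead (e : ℤ) (ht : t < 3) (i j : RelIndex m t) :
    FreeAlgebra.pairCoeff K (g (lead i).1) (g (lead i).2)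
      (relation e (fun x => FreeAlgebra.ι K (g x)) j) = if j = i then 1 else 0 := by
  have hone (k : Fin t) (h : (k : ℕ) ≠ 0) : (k : ℕ) = 1 := by omega
  rcases i with ⟨i, w, w'⟩ | ⟨i, w, k⟩ | k <;> rcases j with ⟨j, v, v'⟩ | ⟨j, v, l⟩ | l
  · fin_cases i <;> fin_cases j <;>
      simp [-zsmul_eq_mul, relation, lead, FreeAlgebra.pairCoeff_mul, hg.eq_iff]
  · by_cases hl : (l : ℕ) = 0 <;> fin_cases i <;> fin_cases j <;>
      simp [-zsmul_eq_mul, relation, lead, FreeAlgebra.pairCoeff_mul, hg.eq_iff, hl]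
  · by_cases hl : (l : ℕ) = 0 <;>
      simp [-zsmul_eq_mul, relation, lead, hl, pairCoeff_extra_inl_left hg]
  · by_cases hk : (k : ℕ) = 0 <;> fin_cases i <;> fin_cases j <;>
      simp [-zsmul_eq_mul, relation, lead, FreeAlgebra.pairCoeff_mul, hg.eq_iff, hk]
  · rcases eq_or_ne l k with rfl | hlk
    · by_cases hl : (l : ℕ) = 0 <;> fin_cases i <;> fin_cases j <;>
        simp [-zsmul_eq_mul, relation, lead, FreeAlgebra.pairCoeff_mul, hg.eq_iff, hl]
    · by_cases hk : (k : ℕ) = 0 <;> by_cases hl : (l : ℕ) = 0 <;> fin_cases j <;>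
        simp [-zsmul_eq_mul, relation, lead, FreeAlgebra.pairCoeff_mul, hg.eq_iff, hk, hl, hlk]
  · by_cases hk : (k : ℕ) = 0 <;> by_cases hl : (l : ℕ) = 0 <;>
      simp [-zsmul_eq_mul, relation, lead, hk, hl, pairCoeff_extra_inl_left hg, pairCoeff_extra_inl_right hg]
  · fin_cases j <;> simp [-zsmul_eq_mul, relation, lead, FreeAlgebra.pairCoeff_mul, hg.eq_iff]
  · by_cases hl : (l : ℕ) = 0 <;> fin_cases j <;>
      simp [-zsmul_eq_mul, relation, lead, FreeAlgebra.pairCoeff_mul, hg.eq_iff, hl]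
  · by_cases hk : (k : ℕ) = 0 <;> by_cases hl : (l : ℕ) = 0 <;>
      simp [-zsmul_eq_mul, relation, lead, hl, pairCoeff_extra hg, Fin.ext_iff, hk, hone]

end

theorem linearIndependent_relation {g : Gen m t → X} (hg : Function.Injective g) (e : ℤ)
    (ht : t < 3) : LinearIndependent K (relation e fun x => FreeAlgebra.ι K (g x)) := by
  classical
  refine .of_pairwise_dual_eq_zero_one _
    (fun i => FreeAlgebra.pairCoeff K (g (lead i).1) (g (lead i).2)) (fun i j hij => ?_) fun i => ?_
  · simp [pairCoeff_lead hg e ht, hij.symm]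
  · simp [pairCoeff_lead hg e ht]

end Linear

/-! ### From labelled letters to label-free operators -/

section Operators

variable (g : Gen m t → R)

/-- The labelled letter `i`, acting on functions of a list of labels: it consumes the first label. -/
def labelled (i : Fin 3) : (List (Fin m) → R) →+ (List (Fin m) → R) where
  toFun f
    -- The value 0 is harmless: all terms of a relation have the same number of labelled letters, so
    -- on a list that is too short they all vanish.
    | [] => 0
    | w :: ws => g (.inl (i, w)) * f ws
  map_zero' := by
    ext ws
    cases ws <;> simp
  map_add' f f' := by
    ext ws
    cases ws <;> simp [mul_add]

/-- The unlabelled letter `k`, acting on functions of a list of labels. -/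
def unlabelled (k : ℕ) : (List (Fin m) → R) →+ (List (Fin m) → R) where
  toFun f ws := extra g k * f ws
  map_zero' := by
    ext
    simp
  map_add' f f' := by
    ext
    simp [mul_add]

@[simp]
theorem labelled_nil (i : Fin 3) (f : List (Fin m) → R) : labelled g i f [] = 0 := rfl

@[simp]
theorem labelled_cons (i : Fin 3) (f : List (Fin m) → R) (w : Fin m) (ws : List (Fin m)) :
    labelled g i f (w :: ws) = g (.inl (i, w)) * f ws := rfl

@[simp]
theorem unlabelled_apply (k : ℕ) (f : List (Fin m) → R) (ws : List (Fin m)) :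
    unlabelled g k f ws = extra g k * f ws := rfl

/-- The operator by which a generator acts. -/
def operator : Gen m t → (List (Fin m) → R) →+ (List (Fin m) → R)
  | .inl (i, _) => labelled g i
  | .inr k => unlabelled g k

/-- The labels that the operator of a generator consumes. -/
def labels : Gen m t → List (Fin m)
  | .inl (_, w) => [w]
  | .inr _ => []

theorem operator_labels (x : Gen m t) (f : List (Fin m) → R) (ws : List (Fin m)) :
    operator g x f (labels x ++ ws) = g x * f ws := by
  rcases x with ⟨i, w⟩ | k <;> simp [operator, labels, extra]

theorem operator_mem (ht : t < 3) (x : Gen m t) :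
    operator g x ∈ ({labelled g 0, labelled g 1, labelled g 2, unlabelled g 1, unlabelled g 0} :
      Set ((List (Fin m) → R) →+ (List (Fin m) → R))) := by
  rcases x with ⟨i, w⟩ | ⟨k, hk⟩
  · fin_cases i <;> simp [operator]
  · obtain rfl | rfl : k = 0 ∨ k = 1 := by omega
    all_goals simp [operator]

/-- Evaluating an operator relation at a list of labels gives one labelled relation, for the labels
at the head of the list, multiplied on the right by a value of the function. A letter p or q that is
absent acts as 0, and the relations that contain it hold trivially or reduce to those that remain.
-/
theorem twistedRelations {e : ℤ} (hg : ∀ i, relation e g i = 0)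
    (hN : (e = 1 ∧ ∀ x : R, (127 * 64673 * 661715 : ℤ) • x = 0 → x = 0) ∨
      (e = -1 ∧ ∀ x : R, (81 * 1133 * 653 : ℤ) • x = 0 → x = 0)) :
    TwistedRelations e (labelled g 0) (labelled g 1) (labelled g 2) (unlabelled g 1)
      (unlabelled g 0) := by
  have hbb w w' := hg (.inl (0, w, w'))
  have hbc w w' := hg (.inl (1, w, w'))
  have hca w w' := hg (.inl (2, w, w'))
  simp only [relation, Matrix.cons_val] at hbb hbc hca
  have hbq w : g (.inl (1, w)) * extra g 0 - g (.inl (2, w)) * extra g 0 -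
      extra g 0 * g (.inl (1, w)) - extra g 0 * g (.inl (0, w)) = 0 := by
    by_cases h : 0 < t
    · simpa [relation, extra, h] using hg (.inr (.inl (0, w, ⟨0, h⟩)))
    · simp [extra, h]
  have haq w : g (.inl (0, w)) * extra g 0 + e • (extra g 0 * g (.inl (2, w))) +
      e • (extra g 0 * g (.inl (0, w))) = 0 := by
    by_cases h : 0 < t
    · simpa [relation, extra, h] using hg (.inr (.inl (1, w, ⟨0, h⟩)))
    · simp [extra, h]
  have hpb w : extra g 1 * g (.inl (1, w)) - g (.inl (1, w)) * extra g 1 +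
      g (.inl (2, w)) * extra g 1 - e • (g (.inl (0, w)) * extra g 1) = 0 := by
    by_cases h : 1 < t
    · simpa [relation, extra, h] using hg (.inr (.inl (0, w, ⟨1, h⟩)))
    · simp [extra, h]
  have hpc w : extra g 1 * g (.inl (2, w)) - g (.inl (1, w)) * extra g 1 = 0 := by
    by_cases h : 1 < t
    · simpa [relation, extra, h] using hg (.inr (.inl (1, w, ⟨1, h⟩)))
    · simp [extra, h]
  have hqq : extra g 0 * extra g 0 - extra g 1 * extra g 0 = 0 := by
    by_cases h : 0 < t
    · simpa [relation] using hg (.inr (.inr ⟨0, h⟩))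
    · simp [extra, h]
  have hpp : extra g 1 * extra g 1 - extra g 0 * extra g 1 - extra g 1 * extra g 0 = 0 := by
    by_cases h : 1 < t
    · simpa [relation] using hg (.inr (.inr ⟨1, h⟩))
    · simp [extra, h]
  constructor
  · intro f
    ext (_ | ⟨w, _ | ⟨w', ws⟩⟩) <;> simp [-zsmul_eq_mul]
    linear_combination (norm := noncomm_ring) hbb w w' * f ws
  · intro f
    ext (_ | ⟨w, _ | ⟨w', ws⟩⟩) <;> simp [-zsmul_eq_mul]
    linear_combination (norm := noncomm_ring) hbc w w' * f ws
  · intro f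
    ext (_ | ⟨w, _ | ⟨w', ws⟩⟩) <;> simp [-zsmul_eq_mul]
    linear_combination (norm := noncomm_ring) hca w w' * f ws
  · intro f
    ext (_ | ⟨w, ws⟩) <;> simp [-zsmul_eq_mul]
    linear_combination (norm := noncomm_ring) hpb w * f ws
  · intro f
    ext (_ | ⟨w, ws⟩) <;> simp [-zsmul_eq_mul]
    linear_combination (norm := noncomm_ring) hpc w * f ws
  · intro f
    ext (_ | ⟨w, ws⟩) <;> simp [-zsmul_eq_mul]
    linear_combination (norm := noncomm_ring) hbq w * f ws
  · intro f
    ext (_ | ⟨w, ws⟩) <;> simp [-zsmul_eq_mul]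
    linear_combination (norm := noncomm_ring) haq w * f ws
  · intro f
    ext ws
    simp
    linear_combination (norm := noncomm_ring) -(hqq * f ws)
  · intro f
    ext ws
    simp
    -- Subtracting `hqq` trades pq for qq and turns pp = qp + pq into pp = qp + qq.
    linear_combination (norm := noncomm_ring) hpp * f ws - hqq * f ws
  · exact hN.imp (And.imp_right fun hx f hf => funext fun ws => hx _ (congrFun hf ws))
      (And.imp_right fun hx f hf => funext fun ws => hx _ (congrFun hf ws))

theorem five_mul_eq_zero {e : ℤ} (ht : t < 3) (hg : ∀ i, relation e g i = 0)
    (hN : (e = 1 ∧ ∀ x : R, (127 * 64673 * 661715 : ℤ) • x = 0 → x = 0) ∨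
      (e = -1 ∧ ∀ x : R, (81 * 1133 * 653 : ℤ) • x = 0 → x = 0)) (x : Fin 5 → Gen m t) :
    g (x 0) * (g (x 1) * (g (x 2) * (g (x 3) * g (x 4)))) = 0 := by
  -- The operators act on the constant function 1, evaluated at the concatenated labels of the five
  -- generators, so each operator consumes exactly the label of its own generator.
  have h := congrFun ((twistedRelations g hg hN).apply_five (fun _ => 1)
    fun i => operator_mem g ht (x i))
    (labels (x 0) ++ (labels (x 1) ++ (labels (x 2) ++ (labels (x 3) ++ (labels (x 4) ++ [])))))
  simpa only [operator_labels, mul_one, Pi.zero_apply] using h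

end Operators

end BlowUp

/-! ### Choice of the sign, number of relations, and the theorem -/

namespace BlowUp

variable {K : Type*} [Field K] {m t n : ℕ}

/-- The sign `e` is regular for the field `K`. -/
def IsRegularSign (K : Type*) [Field K] (e : ℤ) : Prop :=
  (e = 1 ∧ ((127 * 64673 * 661715 : ℤ) : K) ≠ 0) ∨ (e = -1 ∧ ((81 * 1133 * 653 : ℤ) : K) ≠ 0)

/-- The two integers are coprime, so a Bézout identity shows that they cannot both vanish in `K`. -/
theorem exists_isRegularSign (K : Type*) [Field K] : ∃ e : ℤ, IsRegularSign K e := by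
  by_cases h : ((81 * 1133 * 653 : ℤ) : K) = 0
  · refine ⟨1, .inl ⟨rfl, fun h' => ?_⟩⟩
    have hc : IsCoprime (127 * 64673 * 661715 : ℤ) (81 * 1133 * 653) := by
      rw [Int.isCoprime_iff_gcd_eq_one]
      norm_num
    obtain ⟨u, v, huv⟩ := hc
    have := congrArg (Int.cast : ℤ → K) huv
    rw [Int.cast_add, Int.cast_mul u, Int.cast_mul v, h, h'] at this
    simp at this
  · exact ⟨-1, .inr ⟨rfl, h⟩⟩

theorem eq_zero_of_zsmul {A : Type*} [Ring A] [Algebra K A] {N : ℤ} (hN : (N : K) ≠ 0) (x : A)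
    (hx : N • x = 0) : x = 0 := by
  rw [← Int.cast_smul_eq_zsmul K] at hx
  exact (smul_eq_zero.mp hx).resolve_left hN

/-- One has (3m + t)²/3 = 3m² + 2mt + t²/3, and ⌈t²/3⌉ = t for t = 0, 1, 2. -/
theorem ceil_sq_div_three (ht : t < 3) :
    ⌈((3 * m + t : ℕ) : ℚ) ^ 2 / 3⌉₊ = Fintype.card (RelIndex m t) := by
  simp only [Fintype.card_sum, Fintype.card_prod, Fintype.card_fin]
  interval_cases t
  · rw [← Nat.ceil_natCast (R := ℚ) (3 * (m * m) + (2 * (m * 0) + 0))]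
    congr 1
    push_cast
    ring
  all_goals
    -- This criterion needs a nonzero value, which t ≥ 1 guarantees; for t = 0 the quotient is an
    -- integer and was treated directly.
    rw [Nat.ceil_eq_iff (by omega)]
    rw [Nat.cast_sub (by omega)]
    push_cast
    constructor <;> nlinarith

/-- The images of the generators in the quotient satisfy the relations, and R_5 is spanned by the
images of words of length five, so `five_mul_eq_zero` applies to a spanning set. Multiplication by a
nonzero integer of `K` is injective on the quotient because it is a vector space over `K`. -/
theorem isStepNilpotent_relation {e : ℤ} (ht : t < 3) {ι : Type*} (σ : ι ≃ RelIndex m t)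
    (ε : Gen m t ≃ Fin n)
    (hN : IsRegularSign K e) :
    IsStepNilpotent (fun i => relation e (fun x => FreeAlgebra.ι K (ε x)) (σ i)) 5 := by
  set r := fun i => relation e (fun x => FreeAlgebra.ι K (ε x)) (σ i) with hr
  let π : FreeAlgebra K (Fin n) →ₐ[K] PresentedAlgebra r := RingQuot.mkAlgHom K _
  have hg (i : RelIndex m t) : relation e (fun x => π (FreeAlgebra.ι K (ε x))) i = 0 := by
    have h := map_relation π.toRingHom e (fun x => FreeAlgebra.ι K (ε x)) i
    refine h.symm.trans ?_
    have h' := RingQuot.mkAlgHom_rel K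
      (s := fun a b : FreeAlgebra K (Fin n) => ∃ i, a = r i ∧ b = 0) ⟨σ.symm i, rfl, rfl⟩
    simpa [hr] using h'
  rw [IsStepNilpotent, PresentedAlgebra.component, freeHomogeneous, Submodule.map_span,
    Submodule.span_eq_bot]
  rintro _ ⟨_, ⟨w, rfl⟩, rfl⟩
  have h := five_mul_eq_zero (fun x => π (FreeAlgebra.ι K (ε x))) ht hg
    (hN.imp (And.imp_right eq_zero_of_zsmul) (And.imp_right eq_zero_of_zsmul))
    (fun i => ε.symm (w i))
  simpa [List.ofFn_succ, π] using h

end BlowUp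

theorem theorem1 (K : Type*) [Field K] (n : ℕ) (hn : 0 < n) :
    ∃ r : Fin ⌈(n : ℚ) ^ 2 / 3⌉₊ → FreeAlgebra K (Fin n),
      LinearIndependent K r ∧ IsQuadraticPresentation r ∧ IsStepNilpotent r 5 := by
  obtain ⟨e, he⟩ := BlowUp.exists_isRegularSign K
  obtain ⟨m, t, ht, rfl⟩ : ∃ m t, t < 3 ∧ n = 3 * m + t :=
    ⟨n / 3, n % 3, Nat.mod_lt _ (by norm_num), (Nat.div_add_mod n 3).symm⟩
  let ε : BlowUp.Gen m t ≃ Fin (3 * m + t) := Fintype.equivFinOfCardEq (by simp)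
  let σ : Fin ⌈((3 * m + t : ℕ) : ℚ) ^ 2 / 3⌉₊ ≃ BlowUp.RelIndex m t :=
    (Fintype.equivFinOfCardEq (BlowUp.ceil_sq_div_three ht).symm).symm
  exact ⟨fun i => BlowUp.relation e (fun x => FreeAlgebra.ι K (ε x)) (σ i),
    (BlowUp.linearIndependent_relation ε.injective e ht).comp σ σ.injective,
    fun i => BlowUp.relation_mem e ε (σ i), BlowUp.isStepNilpotent_relation ht σ ε he⟩
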